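/- **Setting.** A finite abelian hypergroup $\mathcal T$ is a finite basis, containing the identity $1$, of a commutative associative complex algebra with involution $a\mapsto\overline a$ preserving $\mathcal T$, whose structure constants ($ab=\sum_c n_{a,b}^c\,c$) satisfy $n_{a,b}^c\ge 0$, $\sum_c n_{a,b}^c=1$, and $n_{a,b}^1\neq 0$ iff $b=\overline a$. The weight of $a$ is $w_a=1/n_{a,\overline a}^1$, and $\varpi_X=\sum_{x\in X}w_x$ for $X\subset\mathcal T$. A character is a nonzero function $\mathcal X:\mathcal T\to\mathbb C$ with $\mathcal X(a)\mathcal X(b)=\sum_c n_{a,b}^c\mathcal X(c)$ and $\mathcal X(\overline a)=\overline{\mathcal X(a)}$. Assume $\mathcal T$ is strong: the pointwise products $\mathcal X_\mu\mathcal X_\nu=\sum_\gamma m_{\mu,\nu}^\gamma\mathcal X_\gamma$ have coefficients $m_{\mu,\nu}^\gamma\ge 0$. Then the set $\mathcal T^*$ of characters is a finite abelian hypergroup with structure constants $m$, the trivial character as identity, and complex conjugation $\mathcal X_\mu\mapsto\mathcal X_{\overline\mu}$ as involution; weights in $\mathcal T^*$ are those of this hypergroup. A subhypergroup $\mathcal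 N\subset\mathcal T$ is a subset containing $1$ and closed under the involution and under all outcomes $c$ ($n_{a,b}^c\ne0$) of products; $\mathcal N^\perp=\{\mathcal X_\mu:\mathcal X_\mu(a)=1\ \forall a\in\mathcal N\}\subset\mathcal T^*$. For a subhypergroup $\mathcal N$ of $\mathcal T$, the coset of $s$ is $s\mathcal N=\{x: n_{s,b}^x\neq 0\text{ for some }b\in\mathcal N\}$, with weight $w_{s\mathcal N}=\varpi_{s\mathcal N}/\varpi_{\mathcal N}$; likewise for $\mathcal N^\perp$ in $\mathcal T^*$. An element $s$ is invertible if $st=1$ for some element $t$ (similarly in $\mathcal T^*$). Let $\mathcal H_{\mathcal T}$ have orthonormal basis $\{|x\rangle\}_{x\in\mathcal T}$, and let $\mathcal F$ be the map to the Hilbert space with orthonormal basis $\{|\mathcal X_\mu\rangle\}$ given by $$\mathcal F|a\rangle=\sum_\mu\sqrt{w_{\mathcal X_\mu}w_a/\varpi_{\mathcal T^*}}\;\mathcal X_\mu(a)|\mathcal X_\mu\rangle .$$ Put $Z(\mathcal X_\mu)|x\rangle=\mathcal X_\mu(x)|x\rangle$ and $X(a)|y\rangle=\sum_z\sqrt{w_y/w_z}\,n_{a,y}^z|z\rangle$.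 **Theorem (Normal forms for CSS states).** Let $\mathcal N\subset\mathcal T$ be a subhypergroup, $s\in\mathcal T$, $\mathcal X_\varsigma\in\mathcal T^*$. Call $|\psi\rangle$ *stabilized* if $X(a)|\psi\rangle=\mathcal X_\varsigma(a)|\psi\rangle$ for all $a\in\mathcal N$ and $Z(\mathcal X_\mu)|\psi\rangle=\mathcal X_\mu(s)|\psi\rangle$ for all $\mathcal X_\mu\in\mathcal N^\perp$, and *uniquely stabilized* if it is a stabilized unit vector and every stabilized vector is a scalar multiple of it. (a) The stabilized vectors are exactly the elements of $\mathcal V_S=\mathrm{span}\{\psi_y: y\in s\mathcal N\}$, and $\mathcal F(\mathcal V_S)=\mathrm{span}\{\widehat\psi_\nu:\mathcal X_\nu\in\mathcal X_\varsigma\mathcal N^\perp\}$, where $$\psi_y(x)=\sqrt{w_x}\sum_{b\in\mathcal N}n_{x,\overline y}^{b}\,\overline{\mathcal X_\varsigma(b)},\qquad \widehat\psi_\nu(\mu)=\sqrt{w_{\mathcal X_\mu}}\sum_{\mathcal X_\beta\in\mathcal N^\perp}m_{\mu,\overline\nu}^{\beta}\,\mathcal X_\beta(s).$$ For these $y$ and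 $\nu$, $\psi_y$ is supported on $s\mathcal N$ and $\widehat\psi_\nu$ on $\mathcal X_\varsigma\mathcal N^\perp$. A uniquely stabilized state exists iff $\dim\mathcal V_S=1$, and a given stabilized unit vector is uniquely stabilized iff $\dim\mathcal V_S=1$. (b) If $s$ or $\mathcal X_\varsigma$ is invertible, then $$|\psi\rangle=\sum_{x\in s\mathcal N}\sqrt{\frac{w_x\,w_{\mathcal X_{\overline\varsigma}\mathcal N^\perp}}{\varpi_{s\mathcal N}}}\;\overline{\mathcal X_\varsigma(x)}\,|x\rangle$$ is a uniquely stabilized state; moreover $|\mathcal X_\varsigma(s)|=1$ and, up to the global phase $\overline{\mathcal X_\varsigma(s)}$, $$\mathcal F|\psi\rangle=\overline{\mathcal X_\varsigma(s)}\sum_{\mathcal X_\mu\in\mathcal X_\varsigma\mathcal N^\perp}\sqrt{\frac{w_{\mathcal X_\mu}\,w_{s\mathcal N}}{\varpi_{\mathcal X_\varsigma\mathcal N^\perp}}}\;\mathcal X_\mu(s)\,|\mathcal X_\mu\rangle .$$ -/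

import Mathlib

namespace FinHypergroup

/-- A finite abelian hypergroup: a finite basis `T` of a commutative, associative, unital complex
algebra with involution. The product of two basis elements is `a b = ∑ c, coeff a b c • c`, where
`coeff a b` is a probability distribution (the probability of the outcome `c` in `a b`). The
reversibility property is a consequence of these axioms, see `reversibility` below. -/
class AbelianHypergroup (T : Type*) [Fintype T] where
  /-- the structure constants `n_{a b}^c` -/
  coeff : T → T → T → ℝ
  /-- the identity element -/
  unit : T
  /-- the involution -/
  bar : T → T
  coeff_nonneg : ∀ a b c, 0 ≤ coeff a b c
  coeff_comm : ∀ a b c, coeff a b c = coeff b a c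
  coeff_assoc : ∀ a b c d,
    ∑ x, coeff a b x * coeff x c d = ∑ x, coeff b c x * coeff a x d
  coeff_unit_self : ∀ a, coeff unit a a = 1
  coeff_unit_of_ne : ∀ a b, b ≠ a → coeff unit a b = 0
  bar_bar : ∀ a, bar (bar a) = a
  coeff_bar : ∀ a b c, coeff (bar a) (bar b) (bar c) = coeff a b c
  /-- anti-element property -/
  coeff_to_unit : ∀ a b, coeff a b unit ≠ 0 ↔ b = bar a
  /-- normalization property -/
  coeff_sum : ∀ a b, ∑ c, coeff a b c = 1

open AbelianHypergroup

section Basic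

variable {T : Type*} [Fintype T] [AbelianHypergroup T]

/-- The weight `w_a = 1 / n_{a, bar a}^1`. -/
noncomputable def weight (a : T) : ℝ := 1 / coeff a (bar a) (unit : T)

open Classical in
/-- The weight `ϖ_X` of a subset `X`. -/
noncomputable def setWeight (X : Set T) : ℝ := ∑ x with x ∈ X, weight x

/-- An element `a` is invertible if `a b` is the identity (with probability one) for some `b`. -/
def IsInvertible (a : T) : Prop := ∃ b : T, coeff a b unit = 1

/-- The coset `a X = {x | x ∈ a b for some b ∈ X}`. -/
def coset (a : T) (X : Set T) : Set T := {x | ∃ b ∈ X, coeff a b x ≠ 0}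

/-- The weight `ϖ_{a X} / ϖ_X` of the coset `a X`, as an element of the quotient hypergroup by the
subhypergroup `X`. -/
noncomputable def cosetWeight (a : T) (X : Set T) : ℝ := setWeight (coset a X) / setWeight X

theorem weight_pos (a : T) : 0 < weight a :=
  one_div_pos.2 (lt_of_le_of_ne (coeff_nonneg _ _ _) (((coeff_to_unit a (bar a)).2 rfl).symm))

theorem coeff_bar_unit (a : T) : coeff a (bar a) (unit : T) = (weight a)⁻¹ := by
  simp [weight]

theorem coeff_bar_unit' (a : T) : coeff (bar a) a (unit : T) = (weight a)⁻¹ := by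
  rw [coeff_comm, coeff_bar_unit]

theorem weight_bar (a : T) : weight (bar a) = weight a := by
  rw [weight, weight, bar_bar, coeff_comm]

theorem bar_unit : bar (unit : T) = unit :=
  ((coeff_to_unit (unit : T) unit).1 (by simp [coeff_unit_self])).symm

/-- Reversibility: `n_{x y}^z / w_z = n_{bar x, z}^y / w_y`. -/
theorem reversibility (x y z : T) :
    coeff x y z / weight z = coeff (bar x) z y / weight y := by
  have h := coeff_assoc y x (bar z) unit
  rw [Finset.sum_eq_single z, Finset.sum_eq_single (bar y)] at h
  · rw [coeff_bar_unit, coeff_bar_unit, ← coeff_bar x (bar z) (bar y), bar_bar, bar_bar,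
      coeff_comm y x z] at h
    simpa [div_eq_mul_inv] using h
  · intro b _ hb
    have : coeff y b (unit : T) = 0 := by
      by_contra h0
      exact hb ((coeff_to_unit y b).1 h0)
    simp [this]
  · simp
  · intro b _ hb
    have : coeff b (bar z) (unit : T) = 0 := by
      by_contra h0
      have := (coeff_to_unit b (bar z)).1 h0
      exact hb (by rw [← bar_bar b, ← this, bar_bar])
    simp [this]
  · simp

end Basic

/-- A subhypergroup: a subset which is a hypergroup with the same identity, involution and
structure constants. -/
structure Subhypergroup (T : Type*) [Fintype T] [AbelianHypergroup T] where
  carrier : Set T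
  unit_mem : unit ∈ carrier
  bar_mem : ∀ a ∈ carrier, bar a ∈ carrier
  mul_mem : ∀ a ∈ carrier, ∀ b ∈ carrier, ∀ c, coeff a b c ≠ 0 → c ∈ carrier

/-- A character of a hypergroup. -/
@[ext]
structure Character (T : Type*) [Fintype T] [AbelianHypergroup T] where
  toFun : T → ℂ
  ne_zero' : toFun ≠ 0
  map_mul' : ∀ a b, toFun a * toFun b = ∑ c, (coeff a b c : ℂ) * toFun c
  map_bar' : ∀ a, toFun (bar a) = star (toFun a)

section Dual

variable {T : Type*} [Fintype T] [AbelianHypergroup T]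

instance : CoeFun (Character T) (fun _ => T → ℂ) := ⟨Character.toFun⟩

theorem Character.map_unit (χ : Character T) : χ unit = 1 := by
  obtain ⟨a, ha⟩ := Function.ne_iff.1 χ.ne_zero'
  have h := χ.map_mul' unit a
  rw [Finset.sum_eq_single a] at h
  · rw [coeff_unit_self] at h
    have ha' : χ a ≠ 0 := ha
    exact mul_right_cancel₀ ha' (by simpa using h)
  · intro b _ hb
    simp [coeff_unit_of_ne a b hb]
  · simp

/-- Distinct characters are orthogonal. -/
theorem Character.orthogonal (μ ν : Character T) (h : μ ≠ ν) :
    ∑ a, (weight a : ℂ) * star (μ a) * ν a = 0 := by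
  have key : ∀ b, ν b * ∑ a, (weight a : ℂ) * star (μ a) * ν a
      = μ b * ∑ a, (weight a : ℂ) * star (μ a) * ν a := by
    intro b
    have h1 : ν b * ∑ a, (weight a : ℂ) * star (μ a) * ν a
        = ∑ a, ∑ c, (weight a : ℂ) * star (μ a) * ((coeff b a c : ℂ) * ν c) := by
      rw [Finset.mul_sum]
      refine Finset.sum_congr rfl fun a _ => ?_
      rw [← Finset.mul_sum, ← ν.map_mul']
      ring
    have h2 : μ b * ∑ a, (weight a : ℂ) * star (μ a) * ν a
        = ∑ c, ∑ a, (weight c : ℂ) * ν c * ((coeff (bar b) c a : ℂ) * star (μ a)) := by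
      rw [Finset.mul_sum]
      refine Finset.sum_congr rfl fun c _ => ?_
      rw [← Finset.mul_sum]
      have h3 := congrArg star (μ.map_mul' (bar b) c)
      rw [star_mul', star_sum, μ.map_bar', star_star] at h3
      have h4 : ∑ a, (coeff (bar b) c a : ℂ) * star (μ a) = μ b * star (μ c) := by
        rw [h3]
        refine Finset.sum_congr rfl fun a _ => ?_
        rw [star_mul', Complex.star_def, Complex.conj_ofReal]
      rw [h4]
      ring
    rw [h1, h2, Finset.sum_comm]
    refine Finset.sum_congr rfl fun c _ => Finset.sum_congr rfl fun a _ => ?_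
    have h5 : weight a * coeff b a c = weight c * coeff (bar b) c a := by
      have h6 := reversibility b a c
      have := weight_pos a
      have := weight_pos c
      field_simp at h6
      linarith
    have h7 : (weight a : ℂ) * (coeff b a c : ℂ) = (weight c : ℂ) * (coeff (bar b) c a : ℂ) := by
      exact_mod_cast h5
    linear_combination (star (μ a) * ν c) * h7
  by_contra h0
  exact h (Character.ext (funext fun b => (mul_right_cancel₀ h0 (key b)).symm))

theorem Character.norm_sum_ne_zero (μ : Character T) :
    ∑ a, (weight a : ℂ) * star (μ a) * μ a ≠ 0 := by
  have h : ∑ a, (weight a : ℂ) * star (μ a) * μ a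
      = ((∑ a, weight a * Complex.normSq (μ a) : ℝ) : ℂ) := by
    push_cast
    refine Finset.sum_congr rfl fun a _ => ?_
    rw [Complex.normSq_eq_conj_mul_self, Complex.star_def, mul_assoc]
  rw [h]
  have hpos : 0 < ∑ a, weight a * Complex.normSq (μ a) := by
    refine Finset.sum_pos' (fun a _ => mul_nonneg (weight_pos a).le (Complex.normSq_nonneg _))
      ⟨unit, Finset.mem_univ _, ?_⟩
    rw [μ.map_unit]
    simpa using weight_pos (unit : T)
  exact_mod_cast hpos.ne'

theorem Character.linearIndependent :
    LinearIndependent ℂ (fun χ : Character T => (χ : T → ℂ)) := by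
  rw [linearIndependent_iff']
  intro s g hg μ hμ
  have h1 : ∑ a, (weight a : ℂ) * star (μ a) * (∑ ν ∈ s, g ν • (ν : T → ℂ)) a = 0 := by
    rw [hg]
    simp
  have h2 : ∑ a, (weight a : ℂ) * star (μ a) * (∑ ν ∈ s, g ν • (ν : T → ℂ)) a
      = ∑ ν ∈ s, g ν * ∑ a, (weight a : ℂ) * star (μ a) * ν a := by
    simp only [Finset.sum_apply, Pi.smul_apply, smul_eq_mul, Finset.mul_sum]
    rw [Finset.sum_comm]
    refine Finset.sum_congr rfl fun ν _ => Finset.sum_congr rfl fun a _ => ?_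
    ring
  rw [h2, Finset.sum_eq_single μ] at h1
  · exact (mul_eq_zero.1 h1).resolve_right μ.norm_sum_ne_zero
  · intro ν _ hν
    rw [Character.orthogonal μ ν hν.symm, mul_zero]
  · intro h
    exact absurd hμ h

instance : Finite (Character T) := (Character.linearIndependent (T := T)).finite

noncomputable instance : Fintype (Character T) := Fintype.ofFinite _

theorem Character.coeff_unique {f g : Character T → ℝ}
    (h : ∀ a, ∑ γ : Character T, (f γ : ℂ) * γ a = ∑ γ : Character T, (g γ : ℂ) * γ a) :
    f = g := by
  have h1 := Fintype.linearIndependent_iff.1 (Character.linearIndependent (T := T))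
    (fun γ => (f γ : ℂ) - g γ) (by
      funext a
      have := h a
      simp only [Finset.sum_apply, Pi.smul_apply, smul_eq_mul, sub_mul, Finset.sum_sub_distrib,
        Pi.zero_apply]
      rw [this, sub_self])
  funext γ
  exact_mod_cast sub_eq_zero.1 (h1 γ)

/-- The trivial character. -/
def Character.trivial : Character T where
  toFun := fun _ => 1
  ne_zero' := fun h => one_ne_zero (congrFun h (unit : T))
  map_mul' := fun a b => by
    have := coeff_sum a b
    simp only [mul_one]
    exact_mod_cast this.symm
  map_bar' := by simp

/-- The complex conjugate of a character. -/
def Character.conj (χ : Character T) : Character T where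
  toFun := fun a => star (χ a)
  ne_zero' := fun h => by
    have := congrFun h (unit : T)
    simp [χ.map_unit] at this
  map_mul' := fun a b => by
    rw [← star_mul', χ.map_mul', star_sum]
    refine Finset.sum_congr rfl fun c _ => ?_
    rw [star_mul', Complex.star_def, Complex.conj_ofReal]
  map_bar' := fun a => by rw [χ.map_bar']

variable (T) in
/-- `T` is strong: the pointwise product of two characters is a linear combination of characters
with non-negative coefficients (these are unique by `Character.coeff_unique`). -/
class IsStrong : Prop where
  exists_coeff : ∀ μ ν : Character T, ∃ m : Character T → ℝ, (∀ γ, 0 ≤ m γ) ∧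
    ∀ a, μ a * ν a = ∑ γ : Character T, (m γ : ℂ) * γ a

/-- The structure constants `m_{μ ν}^γ` of the character hypergroup. -/
noncomputable def Character.mulCoeff [IsStrong T] (μ ν : Character T) : Character T → ℝ :=
  Classical.choose (IsStrong.exists_coeff μ ν)

theorem Character.mulCoeff_nonneg [IsStrong T] (μ ν γ : Character T) :
    0 ≤ Character.mulCoeff μ ν γ :=
  (Classical.choose_spec (IsStrong.exists_coeff μ ν)).1 γ

theorem Character.mul_eq_sum [IsStrong T] (μ ν : Character T) (a : T) :
    μ a * ν a = ∑ γ : Character T, (Character.mulCoeff μ ν γ : ℂ) * γ a :=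
  (Classical.choose_spec (IsStrong.exists_coeff μ ν)).2 a

theorem Character.mulCoeff_eq [IsStrong T] (μ ν : Character T) (g : Character T → ℝ)
    (h : ∀ a, μ a * ν a = ∑ γ : Character T, (g γ : ℂ) * γ a) :
    Character.mulCoeff μ ν = g :=
  Character.coeff_unique fun a => by rw [← Character.mul_eq_sum, h]

theorem Character.conj_conj (μ : Character T) : μ.conj.conj = μ := by
  ext a
  simp [Character.conj]

open Classical in
theorem Character.mulCoeff_trivial [IsStrong T] (μ : Character T) :
    Character.mulCoeff Character.trivial μ = fun γ => if γ = μ then 1 else 0 := by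
  refine Character.mulCoeff_eq _ _ _ fun a => ?_
  rw [Finset.sum_eq_single μ]
  · simp [Character.trivial]
  · intro γ _ hγ
    simp [hγ]
  · simp

theorem Character.weight_sum_eq [IsStrong T] (μ ν : Character T) :
    ∑ a, (weight a : ℂ) * star (μ.conj a) * ν a
      = (Character.mulCoeff μ ν Character.trivial : ℂ) *
        ∑ a, (weight a : ℂ) * star ((Character.trivial : Character T) a) *
          (Character.trivial : Character T) a := by
  have h1 : ∑ a, (weight a : ℂ) * star (μ.conj a) * ν a
      = ∑ γ : Character T, (Character.mulCoeff μ ν γ : ℂ) *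
          ∑ a, (weight a : ℂ) * star ((Character.trivial : Character T) a) * γ a := by
    simp only [Finset.mul_sum]
    rw [Finset.sum_comm]
    refine Finset.sum_congr rfl fun a _ => ?_
    have h2 : star (μ.conj a) = μ a := by simp [Character.conj]
    rw [h2, mul_assoc, Character.mul_eq_sum, Finset.mul_sum]
    refine Finset.sum_congr rfl fun γ _ => ?_
    simp only [Character.trivial, star_one]
    ring
  rw [h1, Finset.sum_eq_single Character.trivial]
  · intro γ _ hγ
    rw [Character.orthogonal _ _ hγ.symm, mul_zero]
  · simp

/-- The character hypergroup `T*` of a strong hypergroup `T`: its hyperoperation is the pointwise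
product of characters, its identity is the trivial character, its involution is complex
conjugation. -/
noncomputable instance [IsStrong T] : AbelianHypergroup (Character T) where
  coeff := Character.mulCoeff
  unit := Character.trivial
  bar := Character.conj
  coeff_nonneg := Character.mulCoeff_nonneg
  coeff_comm := fun μ ν γ => congrFun (Character.mulCoeff_eq μ ν _ fun a => by
    rw [mul_comm, Character.mul_eq_sum]) γ
  coeff_assoc := fun μ ν ρ γ => by
    refine congrFun (Character.coeff_unique
      (f := fun γ => ∑ x, Character.mulCoeff μ ν x * Character.mulCoeff x ρ γ)
      (g := fun γ => ∑ x, Character.mulCoeff ν ρ x * Character.mulCoeff μ x γ) fun a => ?_) γ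
    have h1 : ∑ γ : Character T,
        ((∑ x, Character.mulCoeff μ ν x * Character.mulCoeff x ρ γ : ℝ) : ℂ) * γ a
        = μ a * ν a * ρ a := by
      push_cast
      simp only [Finset.sum_mul]
      rw [Finset.sum_comm, Character.mul_eq_sum μ ν, Finset.sum_mul]
      refine Finset.sum_congr rfl fun x _ => ?_
      rw [mul_assoc, Character.mul_eq_sum x ρ, Finset.mul_sum]
      exact Finset.sum_congr rfl fun γ _ => by ring
    have h2 : ∑ γ : Character T,
        ((∑ x, Character.mulCoeff ν ρ x * Character.mulCoeff μ x γ : ℝ) : ℂ) * γ a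
        = μ a * (ν a * ρ a) := by
      push_cast
      simp only [Finset.sum_mul]
      rw [Finset.sum_comm, Character.mul_eq_sum ν ρ, Finset.mul_sum]
      refine Finset.sum_congr rfl fun x _ => ?_
      rw [mul_left_comm, Character.mul_eq_sum μ x, Finset.mul_sum]
      exact Finset.sum_congr rfl fun γ _ => by ring
    rw [h1, h2, mul_assoc]
  coeff_unit_self := fun μ => by simp [Character.mulCoeff_trivial]
  coeff_unit_of_ne := fun μ ν h => by simp [Character.mulCoeff_trivial, h]
  bar_bar := Character.conj_conj
  coeff_bar := fun μ ν γ => by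
    refine congrFun (Character.coeff_unique
      (f := fun γ : Character T => Character.mulCoeff μ.conj ν.conj γ.conj)
      (g := Character.mulCoeff μ ν) fun a => ?_) γ
    rw [← Character.mul_eq_sum]
    have h1 := congrArg star (Character.mul_eq_sum μ.conj ν.conj a)
    rw [star_sum] at h1
    have h2 : star (μ.conj a * ν.conj a) = μ a * ν a := by
      simp [Character.conj]
    rw [← h2, h1]
    refine Fintype.sum_equiv
      ⟨Character.conj, Character.conj, Character.conj_conj, Character.conj_conj⟩ _ _ fun γ => ?_
    simp [Character.conj]
  coeff_to_unit := fun μ ν => by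
    have h := Character.weight_sum_eq μ ν
    constructor
    · intro h0
      by_contra hne
      rw [Character.orthogonal _ _ (fun e => hne e.symm)] at h
      exact (mul_ne_zero (by exact_mod_cast h0) Character.trivial.norm_sum_ne_zero) h.symm
    · rintro rfl h0
      rw [h0] at h
      exact μ.conj.norm_sum_ne_zero (by simpa using h)
  coeff_sum := fun μ ν => by
    have h := Character.mul_eq_sum μ ν unit
    simp only [Character.map_unit, mul_one] at h
    exact_mod_cast h.symm

/-- The annihilator `N^⊥` of a subhypergroup `N`, a subset of `T*`. -/
def annihilator (N : Subhypergroup T) : Set (Character T) :=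
  {μ | ∀ a ∈ N.carrier, μ a = 1}

end Dual

section Stabilizer

variable {T : Type*} [Fintype T] [AbelianHypergroup T]

open Classical in
/-- The Pauli operator `Z(μ)`, `Z(μ)|x⟩ = μ(x)|x⟩`. -/
noncomputable def pauliZ (μ : Character T) :
    EuclideanSpace ℂ T →ₗ[ℂ] EuclideanSpace ℂ T :=
  Matrix.toEuclideanLin (Matrix.diagonal (μ : T → ℂ))

open Classical in
/-- The Pauli operator `X(a)`, `X(a)|y⟩ = ∑ z, √(w_y / w_z) n_{a y}^z |z⟩`. -/
noncomputable def pauliX (a : T) :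
    EuclideanSpace ℂ T →ₗ[ℂ] EuclideanSpace ℂ T :=
  Matrix.toEuclideanLin
    (Matrix.of fun z y : T => ((√(weight y / weight z) * coeff a y z : ℝ) : ℂ))

open Classical in
/-- The quantum Fourier transform,
`|a⟩ ↦ ∑ μ, √(w_μ w_a / ϖ_{T*}) μ(a) |μ⟩`. -/
noncomputable def qft [IsStrong T] :
    EuclideanSpace ℂ T →ₗ[ℂ] EuclideanSpace ℂ (Character T) :=
  Matrix.toEuclideanLin (Matrix.of fun (μ : Character T) (a : T) =>
    (√(weight μ * weight a / setWeight (Set.univ : Set (Character T))) : ℂ) * μ a)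

/-- The vector `ψ` is stabilized by the `X`-type stabilizer hypergroup `{X(a) : a ∈ N}` with
eigenvalues `ς(a)` and by the `Z`-type stabilizer hypergroup `{Z(μ) : μ ∈ N^⊥}` with eigenvalues
`μ(s)`. -/
def IsStabilized (N : Subhypergroup T) (ς : Character T) (s : T) (ψ : EuclideanSpace ℂ T) : Prop :=
  (∀ a ∈ N.carrier, pauliX a ψ = ς a • ψ) ∧ ∀ μ ∈ annihilator N, pauliZ μ ψ = μ s • ψ

/-- The state `ψ` is the only state stabilized by the two stabilizer hypergroups, up to
normalization and global phase. -/
def IsUniquelyStabilized (N : Subhypergroup T) (ς : Character T) (s : T)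
    (ψ : EuclideanSpace ℂ T) : Prop :=
  ‖ψ‖ = 1 ∧ IsStabilized N ς s ψ ∧ ∀ φ, IsStabilized N ς s φ → ∃ c : ℂ, φ = c • ψ

open Classical in
/-- `ψ_y(x) = √w_x ∑_{b ∈ N} n_{x, bar y}^b conj(ς(b))`. -/
noncomputable def psi (N : Subhypergroup T) (ς : Character T) (y : T) : EuclideanSpace ℂ T :=
  WithLp.toLp 2 fun x : T =>
    (√(weight x) : ℂ) * ∑ b with b ∈ N.carrier, (coeff x (bar y) b : ℂ) * star (ς b)

open Classical in
/-- `ψ̂_ν(μ) = √w_μ ∑_{β ∈ N^⊥} m_{μ, bar ν}^β β(s)`. -/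
noncomputable def psiHat [IsStrong T] (N : Subhypergroup T) (s : T) (ν : Character T) :
    EuclideanSpace ℂ (Character T) :=
  WithLp.toLp 2 fun μ : Character T =>
    (√(weight μ) : ℂ) * ∑ β with β ∈ annihilator N, (coeff μ (bar ν) β : ℂ) * β s

/-- `V_S = span {ψ_y : y ∈ s N}`. -/
noncomputable def stabilizedSpace (N : Subhypergroup T) (ς : Character T) (s : T) :
    Submodule ℂ (EuclideanSpace ℂ T) :=
  Submodule.span ℂ (psi N ς '' coset s N.carrier)

/-- `span {ψ̂_ν : ν ∈ ς N^⊥}`. -/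
noncomputable def dualStabilizedSpace [IsStrong T] (N : Subhypergroup T) (ς : Character T) (s : T) :
    Submodule ℂ (EuclideanSpace ℂ (Character T)) :=
  Submodule.span ℂ (psiHat N s '' coset ς (annihilator N))

open Classical in
/-- The state `∑_{x ∈ s N} √(w_x w_{bar ς N^⊥} / ϖ_{s N}) conj(ς(x)) |x⟩`. -/
noncomputable def cssState [IsStrong T] (N : Subhypergroup T) (ς : Character T) (s : T) :
    EuclideanSpace ℂ T :=
  ∑ x with x ∈ coset s N.carrier,
    ((√(weight x * cosetWeight (bar ς) (annihilator N) / setWeight (coset s N.carrier)) : ℂ) *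
      star (ς x)) • EuclideanSpace.single x (1 : ℂ)

open Classical in
/-- The state `∑_{μ ∈ ς N^⊥} √(w_μ w_{s N} / ϖ_{ς N^⊥}) μ(s) |μ⟩`. -/
noncomputable def cssStateHat [IsStrong T] (N : Subhypergroup T) (ς : Character T) (s : T) :
    EuclideanSpace ℂ (Character T) :=
  ∑ μ with μ ∈ coset ς (annihilator N),
    ((√(weight μ * cosetWeight s N.carrier / setWeight (coset ς (annihilator N))) : ℂ) *
      μ s) • EuclideanSpace.single μ (1 : ℂ)

end Stabilizer

end FinHypergroup

open FinHypergroup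

/-!
Writing a vector as `ψ(x) = √w_x f(x)` turns `X(a)` into the translation `f ↦ f(bar a · )` and
`Z(μ)` into multiplication by `μ`. Stabilized vectors then correspond to the functions with
`f(a z) = conj(ς(a)) f(z)` for `a ∈ N` that are supported on `s N`.

Two facts carry this translation. Characters are complete (`eq_zero_of_haarInner_eq_zero`): the
translations commute, and the orthogonal complement of the characters is stable under them, so if
it were nonzero it would contain a common eigenvector, hence a character. The characters in `N^⊥`
separate the cosets of `N` (`mem_coset_iff_forall_annihilator`): by a maximum principle an
`N`-invariant function is constant on cosets, and by completeness the indicator of a coset, which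
is invariant, is a combination of elements of `N^⊥`. The vectors `ψ_y` span the stabilized space
because convolution with the restriction of `conj ς` to `N` reproduces a stabilized `f` up to a
positive factor (`cosetNormSq_smul_eq_sum`).

None of this needs `T` to be strong, so it applies to `T*` as well. The characters of `T*` are the
evaluations at elements of `T`, the annihilator of `N^⊥` is `N`, and the Fourier transform
exchanges the two kinds of conditions (`isStabilized_qft_iff`). This gives the dual description of
the stabilized space.

The restriction of `conj ς` to `s N` is always stabilized. If `s` is invertible, then products with
`s` have a single outcome, so a stabilized vector is determined by its value at `s`; if `ς` is
invertible, the same argument applies in `T*`. For the normalization, expanding the restriction of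
`conj ς` to `N` in characters and evaluating at the identity gives
`(∑_{b ∈ N} w_b |ς(b)|²) ϖ_{bar ς N^⊥} = ϖ_T` (`cosetNormSq_mul_setWeight`). The Fourier transform
of the normal form follows from uniqueness: for `μ ∈ ς N^⊥` the restriction of `conj μ` to `s N`
is stabilized too, so it is proportional to that of `conj ς` (`fourier_cosetCharacter`).
-/

namespace FinHypergroup
open AbelianHypergroup

/-! ### Translations and completeness of characters -/

section Translation

variable {T : Type*} [Fintype T] [AbelianHypergroup T]

theorem weight_mul_coeff (x y z : T) :
    weight y * coeff x y z = weight z * coeff (bar x) z y := by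
  have h := reversibility x y z
  rw [div_eq_div_iff (weight_pos z).ne' (weight_pos y).ne'] at h
  linarith

theorem weight_mul_coeff_bar (x y b : T) :
    weight y * coeff x (bar y) b = weight b * coeff (bar b) x y := by
  rw [← weight_bar y, weight_mul_coeff, ← coeff_bar (bar x), bar_bar, bar_bar, coeff_comm]

theorem coeff_ne_zero_symm {x y z : T} (h : coeff x y z ≠ 0) : coeff (bar x) z y ≠ 0 := by
  intro h0
  have h1 := weight_mul_coeff x y z
  rw [h0, mul_zero] at h1
  exact (mul_ne_zero (weight_pos y).ne' h) h1

theorem coeff_unit_right (a : T) : coeff a unit a = 1 := by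
  rw [coeff_comm, coeff_unit_self]

theorem weight_unit : weight (unit : T) = 1 := by
  rw [weight, bar_unit, coeff_unit_self, one_div_one]

/-- The translate `z ↦ f (a z)` of a function `f`, where `f` is extended linearly from the basis
`T` to the hypergroup algebra. -/
def translation (a : T) : (T → ℂ) →ₗ[ℂ] (T → ℂ) where
  toFun f z := ∑ c, (coeff a z c : ℂ) * f c
  map_add' f g := by
    funext z
    simp [mul_add, Finset.sum_add_distrib]
  map_smul' r f := by
    funext z
    simp only [Pi.smul_apply, smul_eq_mul, Finset.mul_sum, RingHom.id_apply]
    exact Finset.sum_congr rfl fun c _ => by ring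

theorem translation_apply (a : T) (f : T → ℂ) (z : T) :
    translation a f z = ∑ c, (coeff a z c : ℂ) * f c := rfl

theorem translation_apply_unit (a : T) (f : T → ℂ) : translation a f unit = f a := by
  rw [translation_apply, Finset.sum_eq_single a]
  · simp [coeff_unit_right]
  · intro b _ hb
    simp [coeff_comm a unit b, coeff_unit_of_ne a b hb]
  · simp

/-- The translate of a function at `z` only involves its values on the outcomes of `a z`. -/
theorem translation_apply_eq_of_forall {a z : T} {f : T → ℂ} {k : ℂ}
    (h : ∀ c, coeff a z c ≠ 0 → f c = k) : translation a f z = k := by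
  have h1 : ∀ c, (coeff a z c : ℂ) * f c = (coeff a z c : ℂ) * k := by
    intro c
    by_cases hc : coeff a z c = 0
    · simp [hc]
    · rw [h c hc]
  rw [translation_apply, Finset.sum_congr rfl fun c _ => h1 c, ← Finset.sum_mul,
    ← Complex.ofReal_sum, coeff_sum, Complex.ofReal_one, one_mul]

theorem translation_comm (a b : T) (f : T → ℂ) :
    translation a (translation b f) = translation b (translation a f) := by
  have key : ∀ a b z, translation a (translation b f) z
      = ∑ d, ((∑ c, coeff a z c * coeff b c d : ℝ) : ℂ) * f d := by
    intro a b z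
    simp only [translation_apply, Finset.mul_sum, Complex.ofReal_sum, Finset.sum_mul]
    rw [Finset.sum_comm]
    refine Finset.sum_congr rfl fun c _ => Finset.sum_congr rfl fun d _ => ?_
    push_cast
    ring
  funext z
  rw [key, key]
  refine Finset.sum_congr rfl fun d _ => ?_
  congr 2
  have h := coeff_assoc a z b d
  simp only [coeff_comm _ b d, coeff_comm z b] at h
  exact h

theorem Character.translation_eq (χ : Character T) (a : T) :
    translation a (χ : T → ℂ) = χ a • (χ : T → ℂ) := by
  funext z
  rw [translation_apply, ← χ.map_mul']
  rfl

/-- The inner product on functions for the Haar measure `weight`. -/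
noncomputable def haarInner (g f : T → ℂ) : ℂ := ∑ x, (weight x : ℂ) * star (g x) * f x

theorem haarInner_add (g f f' : T → ℂ) :
    haarInner g (f + f') = haarInner g f + haarInner g f' := by
  simp [haarInner, mul_add, Finset.sum_add_distrib]

theorem haarInner_smul (g f : T → ℂ) (c : ℂ) : haarInner g (c • f) = c * haarInner g f := by
  simp only [haarInner, Finset.mul_sum, Pi.smul_apply, smul_eq_mul]
  exact Finset.sum_congr rfl fun c _ => by ring

theorem haarInner_smul_left (g f : T → ℂ) (c : ℂ) :
    haarInner (c • g) f = star c * haarInner g f := by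
  simp only [haarInner, Finset.mul_sum, Pi.smul_apply, smul_eq_mul, star_mul']
  exact Finset.sum_congr rfl fun c _ => by ring

theorem haarInner_sum {ι : Type*} (s : Finset ι) (g : T → ℂ) (f : ι → T → ℂ) :
    haarInner g (∑ i ∈ s, f i) = ∑ i ∈ s, haarInner g (f i) := by
  simp only [haarInner, Finset.sum_apply, Finset.mul_sum]
  exact Finset.sum_comm

/-- Translation by `bar a` is the adjoint of translation by `a`. -/
theorem haarInner_translation (a : T) (g f : T → ℂ) :
    haarInner g (translation a f) = haarInner (translation (bar a) g) f := by
  simp only [haarInner, translation_apply, star_sum, star_mul', Complex.star_def,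
    Complex.conj_ofReal, Finset.mul_sum, Finset.sum_mul]
  rw [Finset.sum_comm]
  refine Finset.sum_congr rfl fun z _ => Finset.sum_congr rfl fun x _ => ?_
  have h : (weight x : ℂ) * coeff a x z = weight z * coeff (bar a) z x := by
    exact_mod_cast weight_mul_coeff a x z
  linear_combination (starRingEnd ℂ (g x) * f z) * h

theorem haarInner_self_ne_zero {f : T → ℂ} (hf : f ≠ 0) : haarInner f f ≠ 0 := by
  have h : haarInner f f = ((∑ a, weight a * Complex.normSq (f a) : ℝ) : ℂ) := by
    rw [haarInner]
    push_cast
    refine Finset.sum_congr rfl fun a _ => ?_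
    rw [Complex.normSq_eq_conj_mul_self, Complex.star_def, mul_assoc]
  obtain ⟨a, ha⟩ := Function.ne_iff.1 hf
  have hpos : 0 < ∑ a, weight a * Complex.normSq (f a) :=
    Finset.sum_pos' (fun a _ => mul_nonneg (weight_pos a).le (Complex.normSq_nonneg _))
      ⟨a, Finset.mem_univ _, mul_pos (weight_pos a) (Complex.normSq_pos.2 ha)⟩
  rw [h]
  exact_mod_cast hpos.ne'

theorem Character.fun_ne_zero (χ : Character T) : (χ : T → ℂ) ≠ 0 := χ.ne_zero'

/-- A common eigenvector of all translations is proportional to a character: its eigenvalues are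
its values, up to the value at the identity. -/
theorem exists_character_of_eigenvector {v : T → ℂ} (hv : v ≠ 0)
    (h : ∀ a, ∃ l : ℂ, translation a v = l • v) :
    ∃ (χ : Character T) (c : ℂ), (χ : T → ℂ) = c • v := by
  have h1 : ∀ a z, v unit * translation a v z = v a * v z := by
    intro a z
    obtain ⟨l, hl⟩ := h a
    have := translation_apply_unit a v
    rw [hl, Pi.smul_apply, smul_eq_mul] at this
    rw [hl, Pi.smul_apply, smul_eq_mul, ← this]
    ring
  have h0 : v unit ≠ 0 := by
    intro h0
    refine hv (funext fun a => ?_)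
    have := h1 a a
    rw [h0, zero_mul] at this
    exact mul_self_eq_zero.1 this.symm
  set χ : T → ℂ := (v unit)⁻¹ • v with hχ
  have hχ0 : χ ≠ 0 := smul_ne_zero (inv_ne_zero h0) hv
  have hmul : ∀ a, translation a χ = χ a • χ := by
    intro a
    funext z
    simp only [hχ, map_smul, Pi.smul_apply, smul_eq_mul]
    have := h1 a z
    field_simp
    linear_combination this
  refine ⟨⟨χ, hχ0, fun a b => (congrFun (hmul a) b).symm, fun a => ?_⟩, (v unit)⁻¹, rfl⟩
  have h2 := haarInner_translation (bar a) χ χ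
  rw [bar_bar, hmul, hmul, haarInner_smul, haarInner_smul_left χ χ (χ a)] at h2
  exact mul_right_cancel₀ (haarInner_self_ne_zero hχ0) h2

/-- A nonzero space of functions that is stable under all translations contains a character:
inside a minimal such space every translation is a scalar. -/
theorem exists_character_mem {U : Submodule ℂ (T → ℂ)} (hU : U ≠ ⊥)
    (hinv : ∀ a, ∀ f ∈ U, translation a f ∈ U) : ∃ χ : Character T, (χ : T → ℂ) ∈ U := by
  obtain ⟨p, ⟨hp0, hpU, hpinv⟩, hmin⟩ := (wellFounded_lt (α := Submodule ℂ (T → ℂ))).has_min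
    {p | p ≠ ⊥ ∧ p ≤ U ∧ ∀ a, ∀ f ∈ p, translation a f ∈ p} ⟨U, hU, le_rfl, hinv⟩
  have hscalar : ∀ a, ∃ l : ℂ, ∀ f ∈ p, translation a f = l • f := by
    intro a
    have : Nontrivial p := Submodule.nontrivial_iff_ne_bot.2 hp0
    obtain ⟨l, hl⟩ := Module.End.exists_eigenvalue ((translation a).restrict (hpinv a))
    obtain ⟨v, hv⟩ := hl.exists_hasEigenvector
    have hv1 : translation a (v : T → ℂ) = l • (v : T → ℂ) := congrArg Subtype.val hv.apply_eq_smul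
    refine ⟨l, fun f hf => ?_⟩
    have hle : p ≤ Module.End.eigenspace (translation a) l := by
      by_contra hnle
      refine hmin (p ⊓ Module.End.eigenspace (translation a) l) ⟨?_, ?_, ?_⟩
        (inf_lt_left.2 hnle)
      · refine (Submodule.ne_bot_iff _).2 ⟨v, ⟨v.2, ?_⟩, ?_⟩
        · exact Module.End.mem_eigenspace_iff.2 hv1
        · exact fun h => hv.2 (Subtype.ext h)
      · exact inf_le_left.trans hpU
      · rintro b g ⟨hg, hg'⟩
        refine ⟨hpinv b g hg, Module.End.mem_eigenspace_iff.2 ?_⟩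
        rw [translation_comm, Module.End.mem_eigenspace_iff.1 hg', map_smul]
    exact Module.End.mem_eigenspace_iff.1 (hle hf)
  obtain ⟨v, hv, hv0⟩ := (Submodule.ne_bot_iff _).1 hp0
  obtain ⟨χ, c, hχ⟩ := exists_character_of_eigenvector hv0 fun a =>
    (hscalar a).imp fun l hl => hl v hv
  exact ⟨χ, hχ ▸ U.smul_mem c (hpU hv)⟩

/-- The characters are complete: only `0` is orthogonal to all of them. -/
theorem eq_zero_of_haarInner_eq_zero {f : T → ℂ}
    (hf : ∀ χ : Character T, haarInner (χ : T → ℂ) f = 0) : f = 0 := by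
  let U : Submodule ℂ (T → ℂ) :=
    { carrier := {f | ∀ χ : Character T, haarInner (χ : T → ℂ) f = 0}
      add_mem' := fun hf hg χ => by rw [haarInner_add, hf, hg, add_zero]
      zero_mem' := fun χ => by simp [haarInner]
      smul_mem' := fun c f hf χ => by rw [haarInner_smul, hf, mul_zero] }
  by_contra h0
  obtain ⟨χ, hχ⟩ := exists_character_mem (U := U)
    ((Submodule.ne_bot_iff _).2 ⟨f, hf, h0⟩) fun a g hg χ => by
      rw [haarInner_translation, Character.translation_eq, haarInner_smul_left, hg, mul_zero]
  exact haarInner_self_ne_zero χ.fun_ne_zero (hχ χ)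

theorem Character.haarInner_of_ne {μ ν : Character T} (h : μ ≠ ν) :
    haarInner (μ : T → ℂ) (ν : T → ℂ) = 0 :=
  Character.orthogonal μ ν h

/-- A character is orthogonal to the eigenfunctions of a translation for any eigenvalue other than
its own. -/
theorem haarInner_eq_zero_of_ne {f : T → ℂ} {μ : Character T} {a : T} {c : ℂ}
    (hf : translation a f = c • f) (h : μ a ≠ c) : haarInner (μ : T → ℂ) f = 0 := by
  have h1 := haarInner_translation a (μ : T → ℂ) f
  rw [hf, Character.translation_eq, haarInner_smul_left, μ.map_bar', star_star,
    haarInner_smul] at h1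
  by_contra h0
  exact h (mul_right_cancel₀ h0 h1.symm)

theorem haarInner_eq_zero_of_notMem_annihilator {N : Subhypergroup T} {f : T → ℂ}
    (hf : ∀ a ∈ N.carrier, translation a f = f) {μ : Character T} (hμ : μ ∉ annihilator N) :
    haarInner (μ : T → ℂ) f = 0 := by
  simp only [annihilator, Set.mem_ofPred_eq, not_forall] at hμ
  obtain ⟨a, ha, hne⟩ := hμ
  exact haarInner_eq_zero_of_ne (c := 1) (by rw [hf a ha, one_smul]) hne

/-- The expansion of a function in characters. -/
theorem eq_sum_characters (f : T → ℂ) :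
    f = ∑ μ : Character T,
      (haarInner (μ : T → ℂ) f / haarInner (μ : T → ℂ) (μ : T → ℂ)) • (μ : T → ℂ) := by
  rw [← sub_eq_zero]
  refine eq_zero_of_haarInner_eq_zero fun χ => ?_
  rw [sub_eq_add_neg, haarInner_add, ← neg_one_smul ℂ (∑ μ : Character T, _), haarInner_smul,
    haarInner_sum, Finset.sum_eq_single χ]
  · rw [haarInner_smul, div_mul_cancel₀ _ (haarInner_self_ne_zero χ.fun_ne_zero)]
    ring
  · intro μ _ hμ
    rw [haarInner_smul, Character.haarInner_of_ne hμ.symm, mul_zero]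
  · simp

end Translation

/-! ### Cosets and their separation by characters -/

section Coset

variable {T : Type*} [Fintype T] [AbelianHypergroup T] (N : Subhypergroup T)

theorem mem_coset_self (s : T) : s ∈ coset s N.carrier :=
  ⟨unit, N.unit_mem, by simp [coeff_unit_right]⟩

variable {N}

theorem mem_coset_trans {x y z : T} (hxy : y ∈ coset x N.carrier)
    (hyz : z ∈ coset y N.carrier) : z ∈ coset x N.carrier := by
  obtain ⟨b, hb, hbn⟩ := hxy
  obtain ⟨b', hb', hbn'⟩ := hyz
  have h := coeff_assoc x b b' z
  have hpos : 0 < ∑ c, coeff x b c * coeff c b' z :=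
    Finset.sum_pos' (fun c _ => mul_nonneg (coeff_nonneg _ _ _) (coeff_nonneg _ _ _))
      ⟨y, Finset.mem_univ _, mul_pos ((coeff_nonneg _ _ _).lt_of_ne' hbn)
        ((coeff_nonneg _ _ _).lt_of_ne' hbn')⟩
  rw [h] at hpos
  obtain ⟨c, _, hc⟩ := Finset.exists_ne_zero_of_sum_ne_zero hpos.ne'
  exact ⟨c, N.mul_mem b hb b' hb' c (left_ne_zero_of_mul hc), right_ne_zero_of_mul hc⟩

theorem mem_coset_symm {x y : T} (h : y ∈ coset x N.carrier) : x ∈ coset y N.carrier := by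
  obtain ⟨b, hb, hbn⟩ := h
  rw [coeff_comm] at hbn
  refine ⟨bar b, N.bar_mem b hb, ?_⟩
  rw [coeff_comm]
  exact coeff_ne_zero_symm hbn

theorem mem_coset_iff_of_coeff_ne_zero {a z c : T} (s : T) (ha : a ∈ N.carrier)
    (h : coeff a z c ≠ 0) : c ∈ coset s N.carrier ↔ z ∈ coset s N.carrier := by
  have hc : c ∈ coset z N.carrier := ⟨a, ha, by rwa [coeff_comm]⟩
  exact ⟨fun h => mem_coset_trans h (mem_coset_symm hc), fun h => mem_coset_trans h hc⟩

theorem coset_unit : coset unit N.carrier = N.carrier := by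
  ext x
  constructor
  · rintro ⟨b, hb, hbn⟩
    exact N.mul_mem _ N.unit_mem b hb x hbn
  · intro hx
    exact ⟨x, hx, by simp [coeff_unit_self]⟩

theorem setWeight_pos {X : Set T} (hX : X.Nonempty) : 0 < setWeight X := by
  obtain ⟨x, hx⟩ := hX
  exact Finset.sum_pos' (fun a _ => (weight_pos a).le) ⟨x, by simpa using hx, weight_pos x⟩

theorem setWeight_univ : setWeight (Set.univ : Set T) = ∑ x : T, weight x := by
  simp [setWeight]

theorem setWeight_univ_pos : 0 < setWeight (Set.univ : Set T) :=
  setWeight_pos ⟨unit, Set.mem_univ _⟩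

/-- Maximum principle: a real function with `f (a z) = f z` for all `a ∈ N` is constant on the
cosets of `N`, since its value at a maximum on a coset is an average of its other values. -/
theorem eq_on_coset_of_real_invariant {f : T → ℝ}
    (hf : ∀ a ∈ N.carrier, ∀ z, ∑ c, coeff a z c * f c = f z) {s x : T}
    (hx : x ∈ coset s N.carrier) : f x = f s := by
  classical
  obtain ⟨m, hm, hmax⟩ := Finset.exists_max_image
    (Finset.univ.filter (· ∈ coset s N.carrier)) f ⟨s, by simpa using mem_coset_self N s⟩
  simp only [Finset.mem_filter, Finset.mem_univ, true_and] at hm hmax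
  have key : ∀ y ∈ coset s N.carrier, f y = f m := by
    intro y hy
    obtain ⟨b, hb, hby⟩ := mem_coset_trans (mem_coset_symm hm) hy
    rw [coeff_comm] at hby
    have h0 : ∑ c, coeff b m c * (f m - f c) = 0 := by
      simp only [mul_sub, Finset.sum_sub_distrib, ← Finset.sum_mul, coeff_sum, hf b hb m]
      ring
    rw [Finset.sum_eq_zero_iff_of_nonneg] at h0
    · have := (mul_eq_zero.1 (h0 y (Finset.mem_univ _))).resolve_left hby
      linarith
    · intro c _
      by_cases hc : coeff b m c = 0
      · simp [hc]
      · exact mul_nonneg (coeff_nonneg _ _ _)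
          (sub_nonneg.2 (hmax c ((mem_coset_iff_of_coeff_ne_zero s hb hc).2 hm)))
  rw [key x hx, key s (mem_coset_self N s)]

theorem eq_on_coset_of_invariant {f : T → ℂ}
    (hf : ∀ a ∈ N.carrier, translation a f = f) {s x : T}
    (hx : x ∈ coset s N.carrier) : f x = f s := by
  refine Complex.ext ?_ ?_
  · refine eq_on_coset_of_real_invariant (f := fun x => (f x).re) (fun a ha z => ?_) hx
    simpa [translation_apply] using congrArg Complex.re (congrFun (hf a ha) z)
  · refine eq_on_coset_of_real_invariant (f := fun x => (f x).im) (fun a ha z => ?_) hx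
    simpa [translation_apply] using congrArg Complex.im (congrFun (hf a ha) z)

/-- The characters in the annihilator of `N` separate the cosets of `N`. -/
theorem mem_coset_iff_forall_annihilator {s x : T} :
    x ∈ coset s N.carrier ↔ ∀ μ ∈ annihilator N, μ x = μ s := by
  classical
  constructor
  · intro hx μ hμ
    exact eq_on_coset_of_invariant
      (fun a ha => by rw [Character.translation_eq, hμ a ha, one_smul]) hx
  · intro h
    -- The indicator function of `s N` is invariant, so only characters in the annihilator occur
    -- in its expansion.
    set f : T → ℂ := fun z => if z ∈ coset s N.carrier then 1 else 0 with hfdef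
    have hf : ∀ a ∈ N.carrier, translation a f = f := by
      intro a ha
      funext z
      refine translation_apply_eq_of_forall fun c hc => ?_
      simp only [hfdef, mem_coset_iff_of_coeff_ne_zero s ha hc]
    have hfx : f x = f s := by
      rw [eq_sum_characters f]
      simp only [Finset.sum_apply, Pi.smul_apply, smul_eq_mul]
      refine Finset.sum_congr rfl fun μ _ => ?_
      by_cases hμ : μ ∈ annihilator N
      · rw [h μ hμ]
      · rw [haarInner_eq_zero_of_notMem_annihilator hf hμ, zero_div, zero_mul, zero_mul]
    by_contra hx
    simp [hfdef, hx, mem_coset_self N s] at hfx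

end Coset

/-! ### Stabilized vectors -/

section StabilizedSpace

variable {T : Type*} [Fintype T] [AbelianHypergroup T]

/-- The vector with amplitudes `√w_x f(x)`. In this normalization `X(a)` becomes a translation and
`Z(μ)` the multiplication by `μ`. -/
noncomputable def weighted (f : T → ℂ) : EuclideanSpace ℂ T :=
  WithLp.toLp 2 fun x : T => (√(weight x) : ℂ) * f x

theorem weighted_apply (f : T → ℂ) (x : T) : weighted f x = (√(weight x) : ℂ) * f x := rfl

theorem sqrt_weight_ne_zero (x : T) : (√(weight x) : ℂ) ≠ 0 := by
  exact_mod_cast (Real.sqrt_pos.2 (weight_pos x)).ne'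

theorem sqrt_weight_mul_self (x : T) : (√(weight x) : ℂ) * √(weight x) = weight x := by
  exact_mod_cast Real.mul_self_sqrt (weight_pos x).le

theorem weighted_injective : Function.Injective (weighted : (T → ℂ) → EuclideanSpace ℂ T) := by
  intro f g h
  funext x
  have := congrArg (fun ψ : EuclideanSpace ℂ T => ψ x) h
  exact mul_left_cancel₀ (sqrt_weight_ne_zero x) this

theorem weighted_surjective :
    Function.Surjective (weighted : (T → ℂ) → EuclideanSpace ℂ T) := by
  intro ψ
  refine ⟨fun x => (√(weight x) : ℂ)⁻¹ * ψ x, ?_⟩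
  ext x
  rw [weighted_apply, mul_inv_cancel_left₀ (sqrt_weight_ne_zero x)]

theorem weighted_smul (c : ℂ) (f : T → ℂ) : weighted (c • f) = c • weighted f := by
  ext x
  simp only [weighted_apply, Pi.smul_apply, smul_eq_mul, PiLp.smul_apply]
  ring

theorem weighted_sum {ι : Type*} (s : Finset ι) (f : ι → T → ℂ) :
    weighted (∑ i ∈ s, f i) = ∑ i ∈ s, weighted (f i) := by
  ext x
  simp [weighted_apply, Finset.mul_sum]

theorem weighted_zero : weighted (0 : T → ℂ) = 0 := by
  ext x
  simp [weighted_apply]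

theorem pauliZ_weighted (μ : Character T) (f : T → ℂ) :
    pauliZ μ (weighted f) = weighted ((μ : T → ℂ) * f) := by
  classical
  ext x
  simp only [pauliZ, Matrix.toLpLin_apply, Matrix.mulVec_diagonal, weighted, Pi.mul_apply]
  ring

theorem pauliX_weighted (a : T) (f : T → ℂ) :
    pauliX a (weighted f) = weighted (translation (bar a) f) := by
  classical
  ext z
  simp only [pauliX, Matrix.toLpLin_apply, Matrix.mulVec, dotProduct, Matrix.of_apply, weighted,
    translation_apply, Finset.mul_sum]
  refine Finset.sum_congr rfl fun y _ => ?_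
  have h1 : (weight y : ℂ) * coeff a y z = weight z * coeff (bar a) z y := by
    exact_mod_cast weight_mul_coeff a y z
  have h2 := sqrt_weight_mul_self y
  have h3 := sqrt_weight_mul_self z
  have h4 := sqrt_weight_ne_zero z
  rw [Real.sqrt_div (weight_pos y).le]
  push_cast
  field_simp
  linear_combination f y * h1 + coeff a y z * f y * h2 - coeff (bar a) z y * f y * h3

theorem annihilator_apply_ne {N : Subhypergroup T} {s x : T} (hx : x ∉ coset s N.carrier) :
    ∃ μ ∈ annihilator N, μ x ≠ μ s := by
  rw [mem_coset_iff_forall_annihilator] at hx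
  push Not at hx
  exact hx

/-- In terms of `f`, the `X`-type conditions are an equivariance property, and the `Z`-type
conditions say that `f` is supported on `s N`. -/
theorem isStabilized_weighted_iff {N : Subhypergroup T} {ς : Character T} {s : T} {f : T → ℂ} :
    IsStabilized N ς s (weighted f) ↔
      (∀ a ∈ N.carrier, translation a f = star (ς a) • f) ∧
        ∀ x, x ∉ coset s N.carrier → f x = 0 := by
  have hX : ∀ a, pauliX a (weighted f) = ς a • weighted f ↔
      translation (bar a) f = ς a • f := by
    intro a
    rw [pauliX_weighted, ← weighted_smul, weighted_injective.eq_iff]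
  have hZ : ∀ μ : Character T, pauliZ μ (weighted f) = μ s • weighted f ↔
      ∀ x, μ x * f x = μ s * f x := by
    intro μ
    rw [pauliZ_weighted, ← weighted_smul, weighted_injective.eq_iff]
    exact funext_iff
  simp only [IsStabilized, hX, hZ]
  refine and_congr ⟨fun h a ha => ?_, fun h a ha => ?_⟩ ⟨fun h x hx => ?_, fun h μ hμ x => ?_⟩
  · rw [← ς.map_bar', ← h _ (N.bar_mem a ha), bar_bar]
  · rw [h _ (N.bar_mem a ha), ς.map_bar', star_star]
  · obtain ⟨μ, hμ, hne⟩ := annihilator_apply_ne hx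
    by_contra h0
    exact hne (mul_right_cancel₀ h0 (h μ hμ x))
  · by_cases hx : x ∈ coset s N.carrier
    · rw [mem_coset_iff_forall_annihilator.1 hx μ hμ]
    · rw [h x hx, mul_zero, mul_zero]

open Classical in
/-- The conjugate of the character `ς`, cut off to the coset `s N`. -/
noncomputable def cosetCharacter (N : Subhypergroup T) (ς : Character T) (s : T) : T → ℂ :=
  fun x => if x ∈ coset s N.carrier then star (ς x) else 0

theorem translation_cosetCharacter {N : Subhypergroup T} (ς : Character T) (s : T) {a : T}
    (ha : a ∈ N.carrier) :
    translation a (cosetCharacter N ς s) = star (ς a) • cosetCharacter N ς s := by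
  classical
  funext z
  rw [translation_apply, Pi.smul_apply, smul_eq_mul]
  by_cases hz : z ∈ coset s N.carrier
  · simp only [cosetCharacter, hz, if_true, ← star_mul']
    rw [ς.map_mul', star_sum]
    refine Finset.sum_congr rfl fun c _ => ?_
    by_cases hc : coeff a z c = 0
    · simp [hc]
    · rw [if_pos ((mem_coset_iff_of_coeff_ne_zero s ha hc).2 hz), star_mul', Complex.star_def,
        Complex.conj_ofReal]
  · simp only [cosetCharacter, hz, if_false, mul_zero]
    refine Finset.sum_eq_zero fun c _ => ?_
    by_cases hc : coeff a z c = 0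
    · simp [hc]
    · rw [if_neg (fun h => hz ((mem_coset_iff_of_coeff_ne_zero s ha hc).1 h)), mul_zero]

theorem isStabilized_cosetCharacter {N : Subhypergroup T} {ς μ : Character T} (s : T)
    (h : ∀ a ∈ N.carrier, μ a = ς a) :
    IsStabilized N ς s (weighted (cosetCharacter N μ s)) := by
  refine isStabilized_weighted_iff.2 ⟨fun a ha => ?_, fun x hx => if_neg hx⟩
  rw [translation_cosetCharacter μ s ha, h a ha]

theorem psi_eq_weighted (N : Subhypergroup T) (ς : Character T) (y : T) :
    psi N ς y = weighted (translation (bar y) (cosetCharacter N ς unit)) := by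
  classical
  ext x
  rw [weighted_apply, translation_apply]
  simp only [psi, cosetCharacter, coset_unit, Finset.sum_filter, mul_ite, mul_zero,
    coeff_comm x (bar y)]

theorem psi_apply_eq_zero {N : Subhypergroup T} {ς : Character T} {s x y : T}
    (hy : y ∈ coset s N.carrier) (hx : x ∉ coset s N.carrier) : psi N ς y x = 0 := by
  classical
  simp only [psi]
  rw [Finset.sum_eq_zero, mul_zero]
  intro b hb
  rw [Finset.mem_filter] at hb
  have h0 : coeff x (bar y) b = 0 := by
    by_contra h0
    rw [coeff_comm] at h0
    have h1 := coeff_ne_zero_symm h0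
    rw [bar_bar] at h1
    exact hx (mem_coset_trans hy ⟨b, hb.2, h1⟩)
  simp [h0]

theorem isStabilized_psi {N : Subhypergroup T} {ς : Character T} {s y : T}
    (hy : y ∈ coset s N.carrier) : IsStabilized N ς s (psi N ς y) := by
  rw [psi_eq_weighted]
  refine isStabilized_weighted_iff.2 ⟨fun a ha => ?_, fun x hx => ?_⟩
  · rw [translation_comm, translation_cosetCharacter ς _ ha, map_smul]
  · have h := psi_apply_eq_zero (ς := ς) hy hx
    rw [psi_eq_weighted, weighted_apply] at h
    exact (mul_eq_zero.1 h).resolve_left (sqrt_weight_ne_zero x)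

theorem IsStabilized.add {N : Subhypergroup T} {ς : Character T} {s : T}
    {φ ψ : EuclideanSpace ℂ T} (hφ : IsStabilized N ς s φ) (hψ : IsStabilized N ς s ψ) :
    IsStabilized N ς s (φ + ψ) :=
  ⟨fun a ha => by rw [map_add, hφ.1 a ha, hψ.1 a ha, smul_add],
    fun μ hμ => by rw [map_add, hφ.2 μ hμ, hψ.2 μ hμ, smul_add]⟩

theorem IsStabilized.smul {N : Subhypergroup T} {ς : Character T} {s : T}
    {φ : EuclideanSpace ℂ T} (hφ : IsStabilized N ς s φ) (c : ℂ) :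
    IsStabilized N ς s (c • φ) :=
  ⟨fun a ha => by rw [map_smul, hφ.1 a ha, smul_comm],
    fun μ hμ => by rw [map_smul, hφ.2 μ hμ, smul_comm]⟩

open Classical in
/-- The squared norm of the restriction of the character `ς` to the coset `s N`. -/
noncomputable def cosetNormSq (N : Subhypergroup T) (ς : Character T) (s : T) : ℝ :=
  ∑ x with x ∈ coset s N.carrier, weight x * Complex.normSq (ς x)

theorem cosetNormSq_unit_pos (N : Subhypergroup T) (ς : Character T) :
    0 < cosetNormSq N ς unit := by
  classical
  refine Finset.sum_pos' (fun a _ => mul_nonneg (weight_pos a).le (Complex.normSq_nonneg _))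
      ⟨unit, by simpa using mem_coset_self N unit, ?_⟩
  rw [ς.map_unit]
  simpa using weight_pos (unit : T)

theorem norm_sq_weighted_cosetCharacter (N : Subhypergroup T) (ς : Character T) (s : T) :
    ‖weighted (cosetCharacter N ς s)‖ ^ 2 = cosetNormSq N ς s := by
  classical
  rw [EuclideanSpace.norm_sq_eq, cosetNormSq, Finset.sum_filter]
  refine Finset.sum_congr rfl fun x _ => ?_
  rw [weighted_apply, norm_mul, mul_pow, Complex.norm_real, Real.norm_eq_abs, sq_abs,
    Real.sq_sqrt (weight_pos x).le, cosetCharacter]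
  split_ifs
  · rw [norm_star, Complex.sq_norm]
  · simp

/-- Convolution with `cosetCharacter N ς 1` reproduces a stabilized vector up to a positive
factor. -/
theorem cosetNormSq_smul_eq_sum {N : Subhypergroup T} {ς : Character T} {f : T → ℂ}
    (hf : ∀ a ∈ N.carrier, translation a f = star (ς a) • f) :
    (cosetNormSq N ς unit : ℂ) • f
      = ∑ y, ((weight y : ℂ) * f y) • translation (bar y) (cosetCharacter N ς unit) := by
  classical
  funext x
  simp only [Finset.sum_apply, Pi.smul_apply, smul_eq_mul, translation_apply, Finset.mul_sum]
  rw [Finset.sum_comm]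
  have h1 : ∀ b, ∑ y, (weight y : ℂ) * f y * ((coeff (bar y) x b : ℂ) * cosetCharacter N ς unit b)
      = (weight b : ℂ) * cosetCharacter N ς unit b * translation (bar b) f x := by
    intro b
    rw [translation_apply, Finset.mul_sum]
    refine Finset.sum_congr rfl fun y _ => ?_
    have h : (weight y : ℂ) * coeff (bar y) x b = weight b * coeff (bar b) x y := by
      rw [coeff_comm]
      exact_mod_cast weight_mul_coeff_bar x y b
    linear_combination (f y * cosetCharacter N ς unit b) * h
  rw [Finset.sum_congr rfl fun b _ => h1 b]
  rw [cosetNormSq, Finset.sum_filter]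
  push_cast
  rw [Finset.sum_mul]
  refine Finset.sum_congr rfl fun b _ => ?_
  by_cases hb : b ∈ coset unit N.carrier
  · have hb' : b ∈ N.carrier := by rwa [coset_unit] at hb
    rw [hf _ (N.bar_mem b hb'), ς.map_bar', star_star, if_pos hb, cosetCharacter, if_pos hb,
      Pi.smul_apply, smul_eq_mul]
    push_cast
    rw [Complex.normSq_eq_conj_mul_self, Complex.star_def]
    ring
  · rw [cosetCharacter, if_neg hb, if_neg hb]
    simp

theorem isStabilized_iff_mem_stabilizedSpace {N : Subhypergroup T} {ς : Character T} {s : T}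
    {ψ : EuclideanSpace ℂ T} : IsStabilized N ς s ψ ↔ ψ ∈ stabilizedSpace N ς s := by
  constructor
  · obtain ⟨f, rfl⟩ := weighted_surjective ψ
    intro h
    have hf := isStabilized_weighted_iff.1 h
    have hS : (cosetNormSq N ς unit : ℂ) ≠ 0 := by
      exact_mod_cast (cosetNormSq_unit_pos N ς).ne'
    have h1 := congrArg weighted (cosetNormSq_smul_eq_sum hf.1)
    rw [weighted_smul, weighted_sum] at h1
    rw [← inv_smul_smul₀ hS (weighted f), h1]
    refine Submodule.smul_mem _ _ (Submodule.sum_mem _ fun y _ => ?_)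
    rw [weighted_smul, ← psi_eq_weighted]
    by_cases hy : y ∈ coset s N.carrier
    · exact Submodule.smul_mem _ _ (Submodule.subset_span ⟨y, hy, rfl⟩)
    · simp [hf.2 y hy]
  · intro h
    refine Submodule.span_induction ?_ ?_ (fun _ _ _ _ => IsStabilized.add)
      (fun c _ _ h => h.smul c) h
    · rintro _ ⟨y, hy, rfl⟩
      exact isStabilized_psi hy
    · exact ⟨fun a _ => by simp, fun μ _ => by simp⟩

theorem isUniquelyStabilized_iff_finrank {N : Subhypergroup T} {ς : Character T} {s : T}
    {ψ : EuclideanSpace ℂ T} (hnorm : ‖ψ‖ = 1) (hψ : IsStabilized N ς s ψ) :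
    IsUniquelyStabilized N ς s ψ ↔ Module.finrank ℂ (stabilizedSpace N ς s) = 1 := by
  have hψ0 : ψ ≠ 0 := fun h => by simp [h] at hnorm
  have hmem := isStabilized_iff_mem_stabilizedSpace.1 hψ
  rw [finrank_eq_one_iff_of_nonzero' (⟨ψ, hmem⟩ : stabilizedSpace N ς s)
    (fun h => hψ0 (congrArg Subtype.val h))]
  constructor
  · rintro ⟨_, _, h⟩ ⟨φ, hφ⟩
    obtain ⟨c, hc⟩ := h φ (isStabilized_iff_mem_stabilizedSpace.2 hφ)
    exact ⟨c, Subtype.ext hc.symm⟩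
  · intro h
    refine ⟨hnorm, hψ, fun φ hφ => ?_⟩
    obtain ⟨c, hc⟩ := h ⟨φ, isStabilized_iff_mem_stabilizedSpace.1 hφ⟩
    exact ⟨c, (congrArg Subtype.val hc).symm⟩

theorem exists_isUniquelyStabilized_iff_finrank {N : Subhypergroup T} {ς : Character T} {s : T} :
    (∃ ψ, IsUniquelyStabilized N ς s ψ) ↔
      Module.finrank ℂ (stabilizedSpace N ς s) = 1 := by
  constructor
  · rintro ⟨ψ, hψ⟩
    exact (isUniquelyStabilized_iff_finrank hψ.1 hψ.2.1).1 hψ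
  · intro h
    obtain ⟨⟨v, hv⟩, hv0, -⟩ := finrank_eq_one_iff'.1 h
    have hv0' : v ≠ 0 := fun h => hv0 (Subtype.ext h)
    have hnorm : ‖((‖v‖ : ℂ)⁻¹) • v‖ = 1 := by
      rw [norm_smul, norm_inv, Complex.norm_real, norm_norm,
        inv_mul_cancel₀ (norm_ne_zero_iff.2 hv0')]
    exact ⟨_, (isUniquelyStabilized_iff_finrank hnorm
      ((isStabilized_iff_mem_stabilizedSpace.2 hv).smul _)).2 h⟩

end StabilizedSpace

/-! ### Duality and the Fourier transform -/

section Duality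

variable {T : Type*} [Fintype T] [AbelianHypergroup T] [IsStrong T]

theorem Character.bar_apply (μ : Character T) (a : T) : (bar μ : Character T) a = star (μ a) := rfl

theorem Character.unit_apply (a : T) : (unit : Character T) a = 1 := rfl

theorem Character.mul_apply (μ ν : Character T) (a : T) :
    μ a * ν a = ∑ γ : Character T, (coeff μ ν γ : ℂ) * γ a :=
  Character.mul_eq_sum μ ν a

/-- The weight of a character determines its squared norm. -/
theorem Character.haarInner_self (μ : Character T) :
    haarInner (μ : T → ℂ) (μ : T → ℂ) = setWeight (Set.univ : Set T) / weight μ := by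
  have h := Character.weight_sum_eq (bar μ) μ
  have h1 : ((bar μ : Character T).conj : Character T) = μ := Character.conj_conj μ
  have h2 : Character.mulCoeff (bar μ) μ Character.trivial = (weight μ)⁻¹ := coeff_bar_unit' μ
  rw [h1, h2] at h
  rw [haarInner, h, setWeight_univ]
  simp [Character.trivial]
  ring

/-- The annihilator of a subhypergroup is a subhypergroup of the character hypergroup. -/
noncomputable def dualSubhypergroup (N : Subhypergroup T) : Subhypergroup (Character T) where
  carrier := annihilator N
  unit_mem := fun _ _ => rfl
  bar_mem := fun μ hμ a ha => by rw [Character.bar_apply, hμ a ha, star_one]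
  mul_mem := fun μ hμ ν hν γ hγ => by
    -- The product of `μ` and `ν` is constant on cosets, so it is orthogonal to the characters
    -- outside the annihilator.
    by_contra hmem
    have hinv : ∀ a ∈ N.carrier, translation a ((μ : T → ℂ) * (ν : T → ℂ)) = μ * ν := by
      intro a ha
      funext z
      refine translation_apply_eq_of_forall fun c hc => ?_
      have hcz : c ∈ coset z N.carrier := ⟨a, ha, by rwa [coeff_comm]⟩
      rw [mem_coset_iff_forall_annihilator] at hcz
      rw [Pi.mul_apply, Pi.mul_apply, hcz μ hμ, hcz ν hν]
    have h0 := haarInner_eq_zero_of_notMem_annihilator hinv hmem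
    have h1 : (μ : T → ℂ) * (ν : T → ℂ)
        = ∑ ρ : Character T, (coeff μ ν ρ : ℂ) • (ρ : T → ℂ) := by
      funext a
      rw [Pi.mul_apply, Character.mul_apply]
      simp
    rw [h1, haarInner_sum, Finset.sum_eq_single γ, haarInner_smul] at h0
    · refine mul_ne_zero ?_ (haarInner_self_ne_zero γ.fun_ne_zero) h0
      exact_mod_cast hγ
    · intro ρ _ hρ
      rw [haarInner_smul, Character.haarInner_of_ne hρ.symm, mul_zero]
    · simp

/-- Evaluation at `a`, as a character of the character hypergroup. -/
def evalCharacter (a : T) : Character (Character T) where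
  toFun := fun μ => μ a
  ne_zero' := fun h => one_ne_zero (congrFun h (unit : Character T))
  map_mul' := fun μ ν => Character.mul_apply μ ν a
  map_bar' := fun μ => Character.bar_apply μ a

theorem evalCharacter_apply (a : T) (μ : Character T) : evalCharacter a μ = μ a := rfl

/-- Every character of the character hypergroup is an evaluation: it cannot be orthogonal to all
evaluations, as the characters of `T` are linearly independent functions. -/
theorem exists_eq_evalCharacter (Φ : Character (Character T)) : ∃ a : T, Φ = evalCharacter a := by
  by_contra hne
  push Not at hne
  have h1 : ∀ μ : Character T, (weight μ : ℂ) * star (Φ μ) = 0 := by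
    refine Fintype.linearIndependent_iff.1 (Character.linearIndependent (T := T)) _ ?_
    funext a
    have h2 := Character.haarInner_of_ne (hne a)
    simpa [haarInner, evalCharacter_apply] using h2
  have h2 := h1 unit
  rw [Φ.map_unit, weight_unit] at h2
  simp at h2

theorem evalCharacter_mem_annihilator_iff {N : Subhypergroup T} {a : T} :
    evalCharacter a ∈ annihilator (dualSubhypergroup N) ↔ a ∈ N.carrier := by
  rw [← coset_unit (N := N), mem_coset_iff_forall_annihilator]
  refine forall₂_congr fun μ _ => ?_
  rw [μ.map_unit, evalCharacter_apply]

/-- The coset `ς N^⊥` consists of the characters that agree with `ς` on `N`. -/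
theorem mem_coset_annihilator_iff {N : Subhypergroup T} {ς μ : Character T} :
    μ ∈ coset ς (annihilator N) ↔ ∀ a ∈ N.carrier, μ a = ς a := by
  refine (mem_coset_iff_forall_annihilator (N := dualSubhypergroup N)).trans
    ⟨fun h a ha => h _ (evalCharacter_mem_annihilator_iff.2 ha), fun h Φ hΦ => ?_⟩
  obtain ⟨a, rfl⟩ := exists_eq_evalCharacter Φ
  exact h a (evalCharacter_mem_annihilator_iff.1 hΦ)

/-- The Fourier transform of a function, without normalization. -/
noncomputable def fourier (f : T → ℂ) : Character T → ℂ :=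
  fun μ => ∑ x, (weight x : ℂ) * μ x * f x

theorem fourier_eq_haarInner (f : T → ℂ) (μ : Character T) :
    fourier f μ = haarInner ((bar μ : Character T) : T → ℂ) f := by
  simp [fourier, haarInner, Character.bar_apply]

theorem fourier_translation (a : T) (f : T → ℂ) :
    fourier (translation (bar a) f) = (evalCharacter a : Character T → ℂ) * fourier f := by
  funext μ
  rw [fourier_eq_haarInner, haarInner_translation, Character.translation_eq, haarInner_smul_left,
    Pi.mul_apply, fourier_eq_haarInner, Character.bar_apply, star_star, bar_bar,
    evalCharacter_apply]

theorem fourier_mul (β : Character T) (f : T → ℂ) :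
    fourier ((β : T → ℂ) * f) = translation β (fourier f) := by
  funext μ
  simp only [fourier, translation_apply, Finset.mul_sum]
  rw [Finset.sum_comm]
  refine Finset.sum_congr rfl fun x _ => ?_
  have h := Character.mul_apply β μ x
  rw [Pi.mul_apply, show (weight x : ℂ) * μ x * (β x * f x) = weight x * f x * (β x * μ x) by ring,
    h, Finset.mul_sum]
  exact Finset.sum_congr rfl fun γ _ => by ring

theorem fourier_injective {f : T → ℂ} (h : fourier f = 0) : f = 0 := by
  refine eq_zero_of_haarInner_eq_zero fun χ => ?_
  have := congrFun h (bar χ)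
  rwa [fourier_eq_haarInner, bar_bar] at this

theorem fourier_surjective : Function.Surjective (fourier : (T → ℂ) → Character T → ℂ) := by
  intro g
  refine ⟨∑ μ : Character T, (g (bar μ) / haarInner (μ : T → ℂ) (μ : T → ℂ)) • (μ : T → ℂ), ?_⟩
  funext ν
  rw [fourier_eq_haarInner, haarInner_sum, Finset.sum_eq_single (bar ν)]
  · rw [haarInner_smul, div_mul_cancel₀ _ (haarInner_self_ne_zero (Character.fun_ne_zero _)),
      bar_bar]
  · intro μ _ hμ
    rw [haarInner_smul, Character.haarInner_of_ne hμ.symm, mul_zero]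
  · simp

theorem qft_weighted (f : T → ℂ) :
    qft (weighted f)
      = ((√(setWeight (Set.univ : Set (Character T))))⁻¹ : ℂ) • weighted (fourier f) := by
  classical
  ext μ
  simp only [qft, Matrix.toLpLin_apply, Matrix.mulVec, dotProduct, Matrix.of_apply, weighted,
    fourier, Finset.mul_sum, PiLp.smul_apply, smul_eq_mul]
  refine Finset.sum_congr rfl fun x _ => ?_
  rw [Real.sqrt_div (mul_pos (weight_pos μ) (weight_pos x)).le, Real.sqrt_mul (weight_pos μ).le]
  push_cast
  linear_combination ((√(setWeight (Set.univ : Set (Character T))))⁻¹ : ℂ) * √(weight μ) * μ x *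
    f x * sqrt_weight_mul_self x

theorem sqrt_setWeight_univ_ne_zero :
    ((√(setWeight (Set.univ : Set (Character T))))⁻¹ : ℂ) ≠ 0 := by
  refine inv_ne_zero ?_
  exact_mod_cast (Real.sqrt_pos.2 (setWeight_univ_pos (T := Character T))).ne'

theorem qft_injective :
    Function.Injective (qft : EuclideanSpace ℂ T →ₗ[ℂ] EuclideanSpace ℂ (Character T)) := by
  refine (injective_iff_map_eq_zero _).2 fun ψ hψ => ?_
  obtain ⟨f, rfl⟩ := weighted_surjective ψ
  rw [qft_weighted, smul_eq_zero] at hψ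
  have h1 := hψ.resolve_left sqrt_setWeight_univ_ne_zero
  rw [← weighted_zero, weighted_injective.eq_iff] at h1
  rw [fourier_injective h1, weighted_zero]

theorem qft_surjective :
    Function.Surjective (qft : EuclideanSpace ℂ T →ₗ[ℂ] EuclideanSpace ℂ (Character T)) := by
  intro φ
  obtain ⟨g, hg⟩ := weighted_surjective
    (((√(setWeight (Set.univ : Set (Character T))))⁻¹ : ℂ)⁻¹ • φ)
  obtain ⟨f, rfl⟩ := fourier_surjective g
  exact ⟨weighted f, by rw [qft_weighted, hg, smul_inv_smul₀ sqrt_setWeight_univ_ne_zero]⟩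

theorem qft_pauliX (a : T) (ψ : EuclideanSpace ℂ T) :
    qft (pauliX a ψ) = pauliZ (evalCharacter a) (qft ψ) := by
  obtain ⟨f, rfl⟩ := weighted_surjective ψ
  rw [pauliX_weighted, qft_weighted, qft_weighted, map_smul, pauliZ_weighted,
    fourier_translation]

theorem qft_pauliZ (β : Character T) (ψ : EuclideanSpace ℂ T) :
    qft (pauliZ β ψ) = pauliX (bar β) (qft ψ) := by
  obtain ⟨f, rfl⟩ := weighted_surjective ψ
  rw [pauliZ_weighted, qft_weighted, qft_weighted, map_smul, pauliX_weighted, bar_bar,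
    fourier_mul]

/-- The Fourier transform exchanges the `X`-type and `Z`-type conditions. -/
theorem isStabilized_qft_iff {N : Subhypergroup T} {ς : Character T} {s : T}
    {ψ : EuclideanSpace ℂ T} :
    IsStabilized (dualSubhypergroup N) (evalCharacter (bar s)) ς (qft ψ) ↔
      IsStabilized N ς s ψ := by
  have hX : ∀ a, pauliX a ψ = ς a • ψ ↔
      pauliZ (evalCharacter a) (qft ψ) = evalCharacter a ς • qft ψ := by
    intro a
    rw [← qft_pauliX, ← map_smul, qft_injective.eq_iff]
    rfl
  have hZ : ∀ β : Character T, pauliZ β ψ = β s • ψ ↔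
      pauliX (bar β) (qft ψ) = evalCharacter (bar s) (bar β) • qft ψ := by
    intro β
    rw [← qft_pauliZ, ← map_smul, qft_injective.eq_iff, evalCharacter_apply,
      Character.bar_apply, β.map_bar', star_star]
  simp only [IsStabilized, hX, hZ]
  rw [and_comm]
  refine and_congr ⟨fun h a ha => ?_, fun h Φ hΦ => ?_⟩ ⟨fun h β hβ => ?_, fun h β hβ => ?_⟩
  · exact h _ (evalCharacter_mem_annihilator_iff.2 ha)
  · obtain ⟨a, rfl⟩ := exists_eq_evalCharacter Φ
    exact h a (evalCharacter_mem_annihilator_iff.1 hΦ)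
  · exact h _ ((dualSubhypergroup N).bar_mem β hβ)
  · have := h _ ((dualSubhypergroup N).bar_mem β hβ)
    rwa [bar_bar] at this

/-- The dual generators are the vectors `ψ_ν` of the character hypergroup. The element `s` enters
through evaluation at `bar s`, since `psi` conjugates its character. -/
theorem psiHat_eq_psi (N : Subhypergroup T) (s : T) (ν : Character T) :
    psiHat N s ν = psi (dualSubhypergroup N) (evalCharacter (bar s)) ν := by
  simp only [psiHat, psi, evalCharacter_apply, Character.map_bar', star_star]
  rfl

theorem dualStabilizedSpace_eq (N : Subhypergroup T) (ς : Character T) (s : T) :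
    dualStabilizedSpace N ς s
      = stabilizedSpace (dualSubhypergroup N) (evalCharacter (bar s)) ς := by
  rw [dualStabilizedSpace, stabilizedSpace, funext (psiHat_eq_psi N s)]
  rfl

theorem map_qft_stabilizedSpace (N : Subhypergroup T) (ς : Character T) (s : T) :
    (stabilizedSpace N ς s).map qft = dualStabilizedSpace N ς s := by
  ext φ
  obtain ⟨ψ, rfl⟩ := qft_surjective φ
  rw [dualStabilizedSpace_eq, ← isStabilized_iff_mem_stabilizedSpace, isStabilized_qft_iff,
    isStabilized_iff_mem_stabilizedSpace, Submodule.mem_map]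
  refine ⟨?_, fun h => ⟨ψ, h, rfl⟩⟩
  rintro ⟨φ, hφ, h⟩
  rwa [← qft_injective h]

end Duality

/-! ### Invertible elements -/

section Invertible

variable {T : Type*} [Fintype T] [AbelianHypergroup T]

theorem coeff_eq_zero_of_coeff_eq_one {a b c d : T} (h : coeff a b c = 1) (hd : d ≠ c) :
    coeff a b d = 0 := by
  classical
  have h1 := coeff_sum a b
  rw [← Finset.add_sum_erase _ _ (Finset.mem_univ c), h, add_eq_left,
    Finset.sum_eq_zero_iff_of_nonneg fun _ _ => coeff_nonneg _ _ _] at h1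
  exact h1 d (by simp [hd])

theorem IsInvertible.coeff_bar {a : T} (h : IsInvertible a) : coeff a (bar a) unit = 1 := by
  obtain ⟨b, hb⟩ := h
  rwa [(coeff_to_unit a b).1 (by rw [hb]; exact one_ne_zero)] at hb

theorem IsInvertible.bar {a : T} (h : IsInvertible a) : IsInvertible (bar a) :=
  ⟨a, by rw [coeff_comm, h.coeff_bar]⟩

theorem IsInvertible.normSq_eq_one {a : T} (h : IsInvertible a) (χ : Character T) :
    Complex.normSq (χ a) = 1 := by
  have h1 : χ a * χ (AbelianHypergroup.bar a) = 1 := by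
    rw [χ.map_mul', ← translation_apply]
    refine translation_apply_eq_of_forall fun c hc => ?_
    by_cases hc' : c = unit
    · rw [hc', χ.map_unit]
    · exact absurd (coeff_eq_zero_of_coeff_eq_one h.coeff_bar hc') hc
  rw [χ.map_bar', Complex.star_def, Complex.mul_conj] at h1
  exact_mod_cast h1

/-- If `s` is invertible and `x` is an outcome of `s b`, then `bar s x = b`. -/
theorem IsInvertible.coeff_bar_eq_one {s b x : T} (h : IsInvertible s) (hx : coeff s b x ≠ 0) :
    coeff (AbelianHypergroup.bar s) x b = 1 := by
  classical
  have h0 : ∀ d, d ≠ b → coeff (AbelianHypergroup.bar s) x d = 0 := by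
    intro d hd
    have h1 := coeff_assoc (AbelianHypergroup.bar s) s b d
    rw [Finset.sum_eq_single unit, coeff_unit_of_ne b d hd, mul_zero, eq_comm,
      Finset.sum_eq_zero_iff_of_nonneg
        fun _ _ => mul_nonneg (coeff_nonneg _ _ _) (coeff_nonneg _ _ _)] at h1
    · exact (mul_eq_zero.1 (h1 x (Finset.mem_univ _))).resolve_left hx
    · intro c _ hc
      rw [coeff_comm, coeff_eq_zero_of_coeff_eq_one h.coeff_bar hc, zero_mul]
    · simp
  rw [← coeff_sum (AbelianHypergroup.bar s) x, Finset.sum_eq_single b (fun d _ => h0 d) (by simp)]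

/-- Multiplication by an invertible element has a single outcome. -/
theorem IsInvertible.coeff_eq_one {s b x : T} (h : IsInvertible s) (hx : coeff s b x ≠ 0) :
    coeff s b x = 1 := by
  have h1 := h.bar.coeff_bar_eq_one (b := x) (x := b)
    (by rw [h.coeff_bar_eq_one hx]; exact one_ne_zero)
  rwa [bar_bar] at h1

open Classical in
/-- Translation by an invertible element maps `N` onto the coset `s N` and preserves weights. -/
theorem IsInvertible.sum_coset {s : T} (h : IsInvertible s) (N : Subhypergroup T) {F G : T → ℝ}
    (hFG : ∀ b ∈ N.carrier, ∀ x, coeff s b x ≠ 0 → F x = G b) :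
    ∑ x with x ∈ coset s N.carrier, weight x * F x
      = ∑ b with b ∈ N.carrier, weight b * G b := by
  have hind : ∀ x, (∑ b with b ∈ N.carrier, coeff (AbelianHypergroup.bar s) x b)
      = if x ∈ coset s N.carrier then 1 else 0 := by
    intro x
    split_ifs with hx
    · obtain ⟨b, hb, hbx⟩ := hx
      have h1 := h.coeff_bar_eq_one hbx
      rw [Finset.sum_eq_single b, h1]
      · exact fun d _ hd => coeff_eq_zero_of_coeff_eq_one h1 hd
      · exact fun h => absurd (by simpa using hb) h
    · refine Finset.sum_eq_zero fun b hb => ?_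
      by_contra h0
      have h1 := coeff_ne_zero_symm h0
      rw [bar_bar] at h1
      exact hx ⟨b, by simpa using hb, h1⟩
  have h1 : ∀ x, (if x ∈ coset s N.carrier then weight x * F x else 0)
      = ∑ b with b ∈ N.carrier, weight b * (coeff s b x * F x) := by
    intro x
    have h2 : (if x ∈ coset s N.carrier then weight x * F x else 0)
        = weight x * F x * ∑ b with b ∈ N.carrier, coeff (AbelianHypergroup.bar s) x b := by
      rw [hind]
      split_ifs <;> simp
    rw [h2, Finset.mul_sum]
    refine Finset.sum_congr rfl fun b _ => ?_
    linear_combination -F x * weight_mul_coeff s b x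
  rw [Finset.sum_filter, Finset.sum_congr rfl fun x _ => h1 x, Finset.sum_comm]
  refine Finset.sum_congr rfl fun b hb => ?_
  rw [← Finset.mul_sum]
  congr 1
  have h3 : ∀ x, coeff s b x * F x = coeff s b x * G b := by
    intro x
    by_cases hx : coeff s b x = 0
    · simp [hx]
    · rw [hFG b (by simpa using hb) x hx]
  rw [Finset.sum_congr rfl fun x _ => h3 x, ← Finset.sum_mul, coeff_sum, one_mul]

theorem IsInvertible.apply_eq_mul {s b x : T} (h : IsInvertible s) (hx : coeff s b x ≠ 0)
    (χ : Character T) : χ x = χ s * χ b := by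
  rw [χ.map_mul', ← translation_apply, eq_comm]
  refine translation_apply_eq_of_forall fun c hc => ?_
  by_contra hne
  exact hc (coeff_eq_zero_of_coeff_eq_one (h.coeff_eq_one hx) fun e => hne (by rw [e]))

theorem IsInvertible.cosetNormSq_eq {s : T} (h : IsInvertible s) (N : Subhypergroup T)
    (χ : Character T) : cosetNormSq N χ s = cosetNormSq N χ unit := by
  rw [cosetNormSq, cosetNormSq, coset_unit]
  refine h.sum_coset N fun b _ x hx => ?_
  rw [h.apply_eq_mul hx, Complex.normSq_mul, h.normSq_eq_one, one_mul]

theorem cosetNormSq_eq_setWeight {N : Subhypergroup T} {s : T} {χ : Character T}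
    (hχ : ∀ x, Complex.normSq (χ x) = 1) :
    cosetNormSq N χ s = setWeight (coset s N.carrier) := by
  simp only [cosetNormSq, hχ, mul_one]
  rfl

/-- For invertible `s`, a stabilized vector is determined by its amplitude at `s`. -/
theorem IsStabilized.exists_eq_smul {N : Subhypergroup T} {ς : Character T} {s : T}
    (h : IsInvertible s) {φ ψ : EuclideanSpace ℂ T} (hφ : IsStabilized N ς s φ)
    (hψ : IsStabilized N ς s ψ) (hψ0 : ψ ≠ 0) : ∃ c : ℂ, φ = c • ψ := by
  obtain ⟨f, rfl⟩ := weighted_surjective φ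
  obtain ⟨g, rfl⟩ := weighted_surjective ψ
  have key : ∀ f : T → ℂ, IsStabilized N ς s (weighted f) → ∀ b ∈ N.carrier, ∀ x,
      coeff s b x ≠ 0 → f x = star (ς b) * f s := by
    intro f hf b hb x hx
    have h1 := congrFun ((isStabilized_weighted_iff.1 hf).1 b hb) s
    rw [Pi.smul_apply, smul_eq_mul] at h1
    rw [← h1, eq_comm]
    refine translation_apply_eq_of_forall fun c hc => ?_
    rw [coeff_comm] at hc
    by_contra hne
    exact hc (coeff_eq_zero_of_coeff_eq_one (h.coeff_eq_one hx) fun e => hne (by rw [e]))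
  have hgs : g s ≠ 0 := by
    intro h0
    refine hψ0 ?_
    rw [← weighted_zero]
    congr 1
    funext x
    by_cases hx : x ∈ coset s N.carrier
    · obtain ⟨b, hb, hbx⟩ := hx
      rw [key g hψ b hb x hbx, h0, mul_zero, Pi.zero_apply]
    · exact (isStabilized_weighted_iff.1 hψ).2 x hx
  refine ⟨f s / g s, ?_⟩
  rw [← weighted_smul]
  congr 1
  funext x
  rw [Pi.smul_apply, smul_eq_mul]
  by_cases hx : x ∈ coset s N.carrier
  · obtain ⟨b, hb, hbx⟩ := hx
    rw [key g hψ b hb x hbx, key f hφ b hb x hbx]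
    field_simp
  · rw [(isStabilized_weighted_iff.1 hψ).2 x hx, (isStabilized_weighted_iff.1 hφ).2 x hx,
      mul_zero]

/-- The subhypergroup consisting of the identity. -/
def trivialSubhypergroup (T : Type*) [Fintype T] [AbelianHypergroup T] : Subhypergroup T where
  carrier := {unit}
  unit_mem := rfl
  bar_mem := by
    rintro a rfl
    exact bar_unit
  mul_mem := by
    rintro a rfl b rfl c hc
    by_contra h
    exact hc (coeff_unit_of_ne _ _ h)

end Invertible

/-! ### Normal forms -/

section NormalForm

variable {T : Type*} [Fintype T] [AbelianHypergroup T] [IsStrong T]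

/-- Uniqueness of stabilized vectors. When `ς` is invertible, it plays the part of `s` in the
character hypergroup. -/
theorem IsStabilized.exists_eq_smul_of_or {N : Subhypergroup T} {ς : Character T} {s : T}
    (h : IsInvertible s ∨ IsInvertible ς) {φ ψ : EuclideanSpace ℂ T}
    (hφ : IsStabilized N ς s φ) (hψ : IsStabilized N ς s ψ) (hψ0 : ψ ≠ 0) :
    ∃ c : ℂ, φ = c • ψ := by
  rcases h with h | h
  · exact hφ.exists_eq_smul h hψ hψ0
  · obtain ⟨c, hc⟩ := (isStabilized_qft_iff.2 hφ).exists_eq_smul h (isStabilized_qft_iff.2 hψ)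
      ((map_ne_zero_iff qft qft_injective).2 hψ0)
    exact ⟨c, qft_injective (by rw [hc, map_smul])⟩

theorem haarInner_cosetCharacter_of_notMem {N : Subhypergroup T} {ς μ : Character T} {s : T}
    (hμ : μ ∉ coset (bar ς) (annihilator N)) :
    haarInner (μ : T → ℂ) (cosetCharacter N ς s) = 0 := by
  rw [mem_coset_annihilator_iff] at hμ
  push Not at hμ
  obtain ⟨a, ha, hne⟩ := hμ
  exact haarInner_eq_zero_of_ne (translation_cosetCharacter ς s ha) hne

/-- The weight of the coset `bar ς N^⊥` is inversely proportional to the squared norm of `ς` on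
`N`, by the expansion of `cosetCharacter N ς 1` in characters, evaluated at the identity. -/
theorem cosetNormSq_mul_setWeight (N : Subhypergroup T) (ς : Character T) :
    cosetNormSq N ς unit * setWeight (coset (bar ς) (annihilator N))
      = setWeight (Set.univ : Set T) := by
  classical
  have h := congrFun (eq_sum_characters (cosetCharacter N ς unit)) unit
  have hW : (setWeight (Set.univ : Set T) : ℂ) ≠ 0 := by
    exact_mod_cast setWeight_univ_pos.ne'
  have h1 : ∀ μ : Character T, haarInner (μ : T → ℂ) (cosetCharacter N ς unit)
      = if μ ∈ coset (bar ς) (annihilator N) then (cosetNormSq N ς unit : ℂ) else 0 := by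
    intro μ
    split_ifs with hμ
    · rw [mem_coset_annihilator_iff] at hμ
      rw [haarInner, cosetNormSq, Finset.sum_filter]
      push_cast
      refine Finset.sum_congr rfl fun x _ => ?_
      by_cases hx : x ∈ coset unit N.carrier
      · have hx' : x ∈ N.carrier := by rwa [coset_unit] at hx
        rw [hμ x hx', cosetCharacter, if_pos hx, if_pos hx, Character.bar_apply, star_star]
        push_cast
        rw [Complex.normSq_eq_conj_mul_self, Complex.star_def]
        ring
      · rw [cosetCharacter, if_neg hx, if_neg hx, mul_zero]
        simp
    · exact haarInner_cosetCharacter_of_notMem hμ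
  simp only [Finset.sum_apply, Pi.smul_apply, smul_eq_mul, Character.map_unit, mul_one, h1,
    Character.haarInner_self] at h
  rw [cosetCharacter, if_pos (mem_coset_self N unit), ς.map_unit, star_one] at h
  have h2 : (setWeight (coset (bar ς) (annihilator N)) : ℂ)
      = ∑ μ : Character T, if μ ∈ coset (bar ς) (annihilator N) then (weight μ : ℂ) else 0 := by
    rw [setWeight, Finset.sum_filter]
    push_cast [apply_ite Complex.ofReal]
    rfl
  have h3 : (cosetNormSq N ς unit : ℂ) * setWeight (coset (bar ς) (annihilator N))
      = setWeight (Set.univ : Set T) := by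
    rw [h2, ← mul_one (setWeight (Set.univ : Set T) : ℂ), h, Finset.mul_sum, Finset.mul_sum]
    refine Finset.sum_congr rfl fun μ _ => ?_
    have hμ : (weight μ : ℂ) ≠ 0 := by exact_mod_cast (weight_pos μ).ne'
    split_ifs
    · field_simp
    · simp
  exact_mod_cast h3

theorem cosetNormSq_bar (N : Subhypergroup T) (ς : Character T) (s : T) :
    cosetNormSq N (bar ς) s = cosetNormSq N ς s := by
  simp only [cosetNormSq, Character.bar_apply, Complex.star_def, Complex.normSq_conj]

theorem setWeight_coset_bar (N : Subhypergroup T) (ς : Character T) :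
    setWeight (coset (bar ς) (annihilator N)) = setWeight (coset ς (annihilator N)) := by
  have h1 := cosetNormSq_mul_setWeight N ς
  have h2 := cosetNormSq_mul_setWeight N (bar ς)
  rw [bar_bar, cosetNormSq_bar, ← h1] at h2
  exact (mul_left_cancel₀ (cosetNormSq_unit_pos N ς).ne' h2).symm

theorem normSq_unit_apply (x : T) : Complex.normSq ((unit : Character T) x) = 1 := by
  rw [Character.unit_apply, map_one]

theorem setWeight_mul_setWeight_annihilator (N : Subhypergroup T) :
    setWeight N.carrier * setWeight (annihilator N) = setWeight (Set.univ : Set T) := by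
  have h := cosetNormSq_mul_setWeight N unit
  have h1 : coset unit (annihilator N) = annihilator N := coset_unit (N := dualSubhypergroup N)
  rwa [cosetNormSq_eq_setWeight normSq_unit_apply, coset_unit, bar_unit, h1] at h

theorem setWeight_univ_character :
    setWeight (Set.univ : Set (Character T)) = setWeight (Set.univ : Set T) := by
  classical
  have h := setWeight_mul_setWeight_annihilator (trivialSubhypergroup T)
  have h1 : annihilator (trivialSubhypergroup T) = Set.univ := by
    refine Set.eq_univ_of_forall fun μ a ha => ?_
    rw [Set.mem_singleton_iff.1 ha, μ.map_unit]
  have h2 : setWeight (trivialSubhypergroup T).carrier = 1 := by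
    rw [setWeight, Finset.sum_eq_single unit, weight_unit]
    · intro b hb hne
      exact absurd (Finset.mem_filter.1 hb).2 hne
    · intro h
      exact absurd (by simp [(trivialSubhypergroup T).unit_mem]) h
  rwa [h1, h2, one_mul] at h

/-- The normalization of `cssState`. -/
theorem cosetNormSq_mul_cosetWeight {N : Subhypergroup T} {ς : Character T} {s : T}
    (h : IsInvertible s ∨ IsInvertible ς) :
    cosetNormSq N ς s * cosetWeight (bar ς) (annihilator N) = setWeight (coset s N.carrier) := by
  have hM : setWeight (annihilator N) ≠ 0 :=
    (setWeight_pos ⟨_, (dualSubhypergroup N).unit_mem⟩).ne'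
  have h1 := cosetNormSq_mul_setWeight N ς
  rw [← setWeight_mul_setWeight_annihilator N] at h1
  rw [cosetWeight, ← mul_div_assoc, div_eq_iff hM]
  rcases h with h | h
  · have h2 := h.cosetNormSq_eq N unit
    rw [cosetNormSq_eq_setWeight normSq_unit_apply, cosetNormSq_eq_setWeight normSq_unit_apply,
      coset_unit] at h2
    rw [h.cosetNormSq_eq, h1, h2]
  · have h2 : ∀ x, Complex.normSq (ς x) = 1 := fun x => h.normSq_eq_one (evalCharacter x)
    rw [cosetNormSq_eq_setWeight h2, coset_unit] at h1
    rw [cosetNormSq_eq_setWeight h2,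
      mul_left_cancel₀ (setWeight_pos ⟨_, N.unit_mem⟩).ne' h1]

theorem cssState_eq (N : Subhypergroup T) (ς : Character T) (s : T) :
    cssState N ς s = (√(cosetWeight (bar ς) (annihilator N) / setWeight (coset s N.carrier)) : ℂ) •
      weighted (cosetCharacter N ς s) := by
  classical
  ext x
  simp only [cssState, Finset.sum_filter, PiLp.smul_apply, smul_eq_mul, weighted_apply,
    cosetCharacter, WithLp.ofLp_sum, Finset.sum_apply]
  rw [Finset.sum_eq_single x]
  · split_ifs with hx
    · rw [mul_div_assoc, Real.sqrt_mul (weight_pos x).le]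
      simp
      ring
    · simp
  · intro y _ hy
    split_ifs <;> simp [hy.symm]
  · simp

theorem cssStateHat_apply (N : Subhypergroup T) (ς : Character T) (s : T) (μ : Character T) :
    cssStateHat N ς s μ = open Classical in if μ ∈ coset ς (annihilator N) then
      (√(weight μ) : ℂ) * √(cosetWeight s N.carrier / setWeight (coset ς (annihilator N))) * μ s
      else 0 := by
  classical
  simp only [cssStateHat, Finset.sum_filter, WithLp.ofLp_sum, Finset.sum_apply]
  rw [Finset.sum_eq_single μ]
  · split_ifs with hx
    · rw [mul_div_assoc, Real.sqrt_mul (weight_pos μ).le]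
      simp
    · simp
  · intro y _ hy
    split_ifs <;> simp [hy.symm]
  · simp

theorem normSq_apply_of_or {ς : Character T} {s : T} (h : IsInvertible s ∨ IsInvertible ς) :
    Complex.normSq (ς s) = 1 :=
  h.elim (fun h => h.normSq_eq_one ς) fun h => h.normSq_eq_one (evalCharacter s)

theorem isUniquelyStabilized_cssState {N : Subhypergroup T} {ς : Character T} {s : T}
    (h : IsInvertible s ∨ IsInvertible ς) : IsUniquelyStabilized N ς s (cssState N ς s) := by
  have hA : 0 < setWeight (coset s N.carrier) := setWeight_pos ⟨s, mem_coset_self N s⟩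
  have hC : 0 ≤ cosetWeight (bar ς) (annihilator N) :=
    (div_pos (setWeight_pos ⟨_, mem_coset_self (dualSubhypergroup N) _⟩)
      (setWeight_pos ⟨_, (dualSubhypergroup N).unit_mem⟩)).le
  have hnorm : ‖cssState N ς s‖ = 1 := by
    rw [← pow_left_inj₀ (norm_nonneg _) zero_le_one two_ne_zero, cssState_eq, norm_smul, mul_pow,
      norm_sq_weighted_cosetCharacter, Complex.norm_real, Real.norm_eq_abs, sq_abs,
      Real.sq_sqrt (div_nonneg hC hA.le), div_mul_eq_mul_div, mul_comm,
      cosetNormSq_mul_cosetWeight h, div_self hA.ne', one_pow]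
  have hstab : IsStabilized N ς s (cssState N ς s) := by
    rw [cssState_eq]
    exact (isStabilized_cosetCharacter s fun _ _ => rfl).smul _
  exact ⟨hnorm, hstab, fun φ hφ =>
    hφ.exists_eq_smul_of_or h hstab fun h0 => by simp [h0] at hnorm⟩

/-- On `ς N^⊥`, the Fourier transform of `cosetCharacter N ς s` is proportional to evaluation at
`s`. For `μ` in `ς N^⊥`, the conjugate of `μ` on `s N` is also stabilized, hence proportional to
the conjugate of `ς` by uniqueness. -/
theorem fourier_cosetCharacter {N : Subhypergroup T} {ς μ : Character T} {s : T}
    (h : IsInvertible s ∨ IsInvertible ς) (hμ : μ ∈ coset ς (annihilator N)) :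
    fourier (cosetCharacter N ς s) μ = star (ς s) * μ s * cosetNormSq N ς s := by
  classical
  have hs := normSq_apply_of_or h
  have hs' : star (ς s) * ς s = 1 := by
    rw [Complex.star_def, ← Complex.normSq_eq_conj_mul_self, hs, Complex.ofReal_one]
  have hmem := mem_coset_self N s
  have hne : weighted (cosetCharacter N ς s) ≠ 0 := by
    rw [← weighted_zero, weighted_injective.ne_iff]
    intro h0
    have := congrFun h0 s
    rw [cosetCharacter, if_pos hmem, Pi.zero_apply] at this
    rw [this, zero_mul] at hs'
    exact zero_ne_one hs'
  obtain ⟨c, hc⟩ := (isStabilized_cosetCharacter s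
    (mem_coset_annihilator_iff.1 hμ)).exists_eq_smul_of_or h
      (isStabilized_cosetCharacter s fun _ _ => rfl) hne
  rw [← weighted_smul, weighted_injective.eq_iff] at hc
  have hval : ∀ x ∈ coset s N.carrier, μ x = star c * ς x := by
    intro x hx
    have h1 := congrFun hc x
    rw [Pi.smul_apply, smul_eq_mul, cosetCharacter, cosetCharacter, if_pos hx, if_pos hx] at h1
    rw [← star_star (μ x), h1, star_mul', star_star]
  rw [fourier, cosetNormSq, Finset.sum_filter]
  push_cast
  rw [Finset.mul_sum]
  refine Finset.sum_congr rfl fun x _ => ?_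
  rw [cosetCharacter]
  split_ifs with hx
  · rw [hval x hx, hval s hmem]
    push_cast
    rw [Complex.normSq_eq_conj_mul_self, ← Complex.star_def]
    linear_combination -(weight x : ℂ) * star c * ς x * star (ς x) * hs'
  · simp

theorem qft_cssState {N : Subhypergroup T} {ς : Character T} {s : T}
    (h : IsInvertible s ∨ IsInvertible ς) :
    qft (cssState N ς s) = star (ς s) • cssStateHat N ς s := by
  classical
  ext μ
  rw [cssState_eq, map_smul, qft_weighted, PiLp.smul_apply, PiLp.smul_apply, PiLp.smul_apply,
    weighted_apply, cssStateHat_apply, smul_eq_mul, smul_eq_mul, smul_eq_mul]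
  split_ifs with hμ
  · rw [fourier_cosetCharacter h hμ]
    have hreal : √(cosetWeight (bar ς) (annihilator N) / setWeight (coset s N.carrier)) *
        ((√(setWeight (Set.univ : Set (Character T))))⁻¹ * cosetNormSq N ς s)
        = √(cosetWeight s N.carrier / setWeight (coset ς (annihilator N))) := by
      have h1 := cosetNormSq_mul_cosetWeight (N := N) h
      have hA : 0 < setWeight (coset s N.carrier) := setWeight_pos ⟨s, mem_coset_self N s⟩
      have hC : 0 < setWeight (coset ς (annihilator N)) :=
        setWeight_pos ⟨_, mem_coset_self (dualSubhypergroup N) ς⟩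
      have hM : 0 < setWeight (annihilator N) :=
        setWeight_pos ⟨_, (dualSubhypergroup N).unit_mem⟩
      have hN : 0 < setWeight N.carrier := setWeight_pos ⟨_, N.unit_mem⟩
      rw [cosetWeight, setWeight_coset_bar] at h1 ⊢
      rw [setWeight_univ_character, ← setWeight_mul_setWeight_annihilator N, cosetWeight]
      have hS : cosetNormSq N ς s = setWeight (coset s N.carrier) * setWeight (annihilator N) /
          setWeight (coset ς (annihilator N)) := by
        rw [← h1]
        field_simp
      rw [hS]
      generalize setWeight (coset s N.carrier) = A at *
      generalize setWeight (coset ς (annihilator N)) = C at *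
      generalize setWeight (annihilator N) = M at *
      generalize setWeight N.carrier = n at *
      refine (Real.sqrt_eq_iff_mul_self_eq_of_pos (by positivity)).2 ?_ |>.symm
      have e1 : √(C / M / A) ^ 2 = C / M / A := Real.sq_sqrt (by positivity)
      have e2 : (√(n * M))⁻¹ ^ 2 = (n * M)⁻¹ := by
        rw [inv_pow, Real.sq_sqrt (by positivity)]
      rw [← sq, mul_pow, mul_pow, e1, e2]
      field_simp
    have hcomplex := congrArg (fun r : ℝ => (r : ℂ)) hreal
    push_cast at hcomplex
    linear_combination (√(weight μ) : ℂ) * star (ς s) * μ s * hcomplex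
  · have h0 : fourier (cosetCharacter N ς s) μ = 0 := by
      rw [fourier_eq_haarInner]
      refine haarInner_cosetCharacter_of_notMem fun h1 => hμ ?_
      rw [mem_coset_annihilator_iff] at h1 ⊢
      intro a ha
      have := h1 a ha
      rwa [Character.bar_apply, Character.bar_apply, star_inj] at this
    rw [h0]
    simp

end NormalForm

end FinHypergroup

theorem mainTheorem2 {T : Type*} [Fintype T] [AbelianHypergroup T] [IsStrong T]
    (N : Subhypergroup T) (ς : Character T) (s : T) :
    -- (a) the stabilized states are those of `V_S`, also in the dual description
    (∀ ψ : EuclideanSpace ℂ T, IsStabilized N ς s ψ ↔ ψ ∈ stabilizedSpace N ς s) ∧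
    (stabilizedSpace N ς s).map qft = dualStabilizedSpace N ς s ∧
    (∀ y ∈ coset s N.carrier, ∀ x, x ∉ coset s N.carrier → psi N ς y x = 0) ∧
    (∀ ν ∈ coset ς (annihilator N), ∀ μ, μ ∉ coset ς (annihilator N) → psiHat N s ν μ = 0) ∧
    ((∃ ψ, IsUniquelyStabilized N ς s ψ) ↔ Module.finrank ℂ (stabilizedSpace N ς s) = 1) ∧
    (∀ ψ, ‖ψ‖ = 1 → IsStabilized N ς s ψ →
      (IsUniquelyStabilized N ς s ψ ↔ Module.finrank ℂ (stabilizedSpace N ς s) = 1)) ∧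
    -- (b) the normal form
    (IsInvertible s ∨ IsInvertible ς →
      IsUniquelyStabilized N ς s (cssState N ς s) ∧
      ‖ς s‖ = 1 ∧
      qft (cssState N ς s) = star (ς s) • cssStateHat N ς s) := by
  refine ⟨fun ψ => isStabilized_iff_mem_stabilizedSpace, map_qft_stabilizedSpace N ς s,
    fun y hy x hx => psi_apply_eq_zero hy hx, fun ν hν μ hμ => ?_,
    exists_isUniquelyStabilized_iff_finrank,
    fun ψ hnorm hψ => isUniquelyStabilized_iff_finrank hnorm hψ,
    fun h => ⟨isUniquelyStabilized_cssState h, ?_, qft_cssState h⟩⟩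
  · rw [psiHat_eq_psi]
    exact psi_apply_eq_zero (N := dualSubhypergroup N) hν hμ
  · have h1 := normSq_apply_of_or h
    rw [Complex.normSq_eq_norm_sq] at h1
    exact (pow_eq_one_iff_of_nonneg (norm_nonneg _) two_ne_zero).1 h1
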